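/- Let $V\in\mathbb{R}\setminus\{0\}$, let $\chi\in\mathbb{R}$, and let $F:\mathbb{C}\to\mathbb{C}$ be either the power nonlinearity $F(z)=|z|^{2\sigma}z$ with $\sigma>0$, or the saturable nonlinearity $F(z)=\frac{|z|^2z}{1+|z|^2}$. Consider on $\mathbb{Z}^3$ the discrete nonlinear Schrödinger equation with one nonlinear impurity at the origin, $$ i\,\frac{dC_n}{dt}=V\sum_{|m-n|_1=1}C_m-\chi\,\delta_{n,0}F(C_n),\qquad C_n(0)=\delta_{n,0},\qquad n\in\mathbb{Z}^3,\ t\ge 0, $$ for $C\in C([0,\infty),\ell^2(\mathbb{Z}^3))$. Let $J_0$ be the Bessel function of the first kind of order $0$, let $$ A(t)=\int_0^t|J_0(2V(t-s))|^3\,ds,\qquad \|A\|_\infty=\operatorname*{ess\,sup}_{t\ge 0}A(t), $$ and let $\mathcal{T}$ be the Volterra map $$ \mathcal{T}[u](t)=J_0(2Vt)^3+i\chi\int_0^tJ_0(2V(t-s))^3F(u(s))\,ds . $$ Then $A\in L^\infty([0,\infty))$ and $\|A\|_\infty>0$. Put $$ \chi_{\mathrm{crit}}=\frac{1}{(1+2\sigma)\left(1+\frac1{2\sigma}\right)^{2\sigma}\|A\|_\infty}\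 \text{ (power)},\qquad \chi_{\mathrm{crit}}=\frac{8}{9\|A\|_\infty}\ \text{ (saturable)}. $$ (a) Suppose $|\chi|<\chi_{\mathrm{crit}}$ (in particular this covers $0\le\chi<\chi_{\mathrm{crit}}$). Let $R=1+\frac1{2\sigma}$ in the power case and let $R\ge 9$ be arbitrary in the saturable case. Then $\mathcal{T}$ maps the closed ball $\{u\in L^\infty([0,\infty);\mathbb{C}):\|u\|_\infty\le R\}$ into itself and is a contraction on it, with Lipschitz constant $|\chi|/\chi_{\mathrm{crit}}<1$; so it has exactly one fixed point there. The initial value problem has a solution, and for every solution $C$ one has $C_0(t)=\mathcal{T}[C_0](t)$ for all $t\ge0$, the function $C_0$ is (as an element of $L^\infty$) this fixed point, and $$\lim_{t\to\infty}|C_0(t)|=0.$$ (b) There is a number $\sigma_0$ with $\frac1{100}<\sigma_0<\frac1{50}$, independent of $V$, such that for every $V\neq0$ and every $\sigma>0$ the critical value for the power nonlinearity is smaller than the one for the saturable nonlinearity if and only if $\sigma>\sigma_0$. In particular it is smaller for every $\sigma\ge\frac1{50}$, hence for all $\sigma=1,2,3,\dots$. -/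

import Mathlib

open MeasureTheory Set Filter Topology

namespace DNLS

noncomputable section

/-- The Bessel function `J₀` of the first kind, given by Bessel's integral
`J₀(x) = (1/π) ∫₀^π cos (x sin θ) dθ`. -/
def besselJ0 (x : ℝ) : ℝ :=
  (1 / Real.pi) * ∫ θ in (0 : ℝ)..Real.pi, Real.cos (x * Real.sin θ)

/-- Sites of the cubic lattice `ℤ³`. -/
abbrev Site : Type := Fin 3 → ℤ

/-- Square summable complex sequences on `ℤ³`. -/
abbrev EllTwo : Type := lp (fun _ : Site => ℂ) 2

/-- Nearest neighbour coupling of strength `V` (dispersion `2V (cos k₁ + cos k₂ + cos k₃)`). -/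
def coupling (V : ℝ) (n m : Site) : ℂ :=
  if ∑ j, |n j - m j| = 1 then (V : ℂ) else 0

/-- The power nonlinearity `F(z) = |z|^{2σ} z`. -/
def powerF (σ : ℝ) (z : ℂ) : ℂ := ((‖z‖ ^ (2 * σ) : ℝ) : ℂ) * z

/-- The saturable nonlinearity `F(z) = |z|² z / (1 + |z|²)`. -/
def saturableF (z : ℂ) : ℂ := ((‖z‖ ^ 2 / (1 + ‖z‖ ^ 2) : ℝ) : ℂ) * z

/-- `C ∈ C([0,∞), ℓ²(ℤ³))` solves
`i dCₙ/dt = ∑ₘ V_{n,m} Cₘ - χ δ_{n,0} F(Cₙ)`, `Cₙ(0) = δ_{n,0}`, on `[0,∞)`.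
The sum over `m` has only six nonzero terms. Values of `C` at negative times play no role. -/
structure IsSolution (V χ : ℝ) (F : ℂ → ℂ) (C : ℝ → EllTwo) : Prop where
  continuousOn : ContinuousOn C (Ici 0)
  initial : ∀ n : Site, C 0 n = if n = 0 then 1 else 0
  equation : ∀ t : ℝ, 0 ≤ t → ∀ n : Site, ∃ d : ℂ,
    HasDerivWithinAt (fun s => C s n) d (Ici 0) t ∧
      Complex.I * d =
        (∑' m : Site, coupling V n m * C t m) - (χ : ℂ) * (if n = 0 then F (C t n) else 0)

/-- Lebesgue measure on the half-line `[0,∞)`. -/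
abbrev halfLine : Measure ℝ := volume.restrict (Ici 0)

/-- The Banach space `L^∞([0,∞); ℂ)`. -/
abbrev LInfty : Type := Lp ℂ ⊤ halfLine

/-- The closed ball of radius `R` about `0` in `L^∞([0,∞); ℂ)`. -/
abbrev Ball (R : ℝ) : Type := Metric.closedBall (0 : LInfty) R

/-- The nonlinear Volterra map
`𝒯[u](t) = J₀(2Vt)³ + iχ ∫₀ᵗ J₀(2V(t-s))³ F(u(s)) ds`. -/
def volterra (V χ : ℝ) (F : ℂ → ℂ) (u : ℝ → ℂ) (t : ℝ) : ℂ :=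
  ((besselJ0 (2 * V * t) ^ 3 : ℝ) : ℂ) +
    Complex.I * (χ : ℂ) *
      ∫ s in (0 : ℝ)..t, ((besselJ0 (2 * V * (t - s)) ^ 3 : ℝ) : ℂ) * F (u s)

/-- `A(t) = ∫₀ᵗ |J₀(2V(t-s))|³ ds`. -/
def A (V t : ℝ) : ℝ := ∫ s in (0 : ℝ)..t, |besselJ0 (2 * V * (t - s))| ^ 3

/-- `‖A‖_∞`, the essential supremum of `|A|` over `[0,∞)`. -/
def normA (V : ℝ) : ℝ := (eLpNorm (A V) ⊤ halfLine).toReal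

/-- The critical value for the power nonlinearity. -/
def chiPower (V σ : ℝ) : ℝ :=
  1 / ((1 + 2 * σ) * (1 + 1 / (2 * σ)) ^ (2 * σ) * normA V)

/-- The critical value for the saturable nonlinearity. -/
def chiSaturable (V : ℝ) : ℝ := 8 / (9 * normA V)

end

end DNLS

/-!
Everything reduces to a scalar Volterra equation for the amplitude `C₀` at the impurity.

*Kernel.* In Fourier space the propagator `e^{-itH}` of the hopping operator is multiplication by
the exponential of the dispersion relation, which factorises over the three coordinates; its
diagonal matrix element at the origin is therefore `J₀(2Vt)³` (`propagator_delta0_zero`). By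
Duhamel's formula the origin component of any solution is a fixed point of the Volterra map
(`IsSolution.eq_volterra`), and conversely a continuous fixed point generates a solution
(`isSolution_duhamel`). No a priori bound on `C` is needed for this.

*Integrability.* `w = √x J₀(x)` solves `w'' + (1 + 1/(4x²)) w = 0`, whose energy decreases; so
`x J₀(x)²` is bounded for `x ≥ 1` (`mul_sq_besselJ0_le`), `|J₀|³` is integrable, and `A` is
increasing and bounded with limit its essential supremum.

*Contraction.* If `F` is `L`-Lipschitz and bounded by `M` on the disc of radius `R`, with
`|χ| L ‖A‖_∞ < 1` and `1 + |χ| ‖A‖_∞ M < R` (`Admissible`), the Volterra map contracts the ball of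
radius `R` in `L^∞`. A solution cannot leave the disc (`Admissible.norm_lt_radius`), so its origin
component is the fixed point of the contraction. Splitting the Volterra integral at a large time
shows that an eventual bound `a` for `|C₀|` improves to `p a` with a fixed `p < 1`
(`Admissible.eventually_norm_le`), whence `C₀ → 0`.

*Constants.* A radial map is as Lipschitz as its profile (`norm_radial_sub_le`), which gives
`L = (1 + 2σ) R^{2σ}` for the power and `L = 9/8` for the saturable nonlinearity. The comparison
of the critical values is the comparison of `powerConst σ` with `9/8`; `powerConst` is strictly
increasing and crosses `9/8` between `1/100` and `1/50`.
-/

namespace DNLS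

noncomputable section

/-! ### Decay of the Bessel function -/

/-- `J₀'`, obtained by differentiating Bessel's integral. -/
def besselJ0Deriv (x : ℝ) : ℝ :=
  (1 / Real.pi) * ∫ θ in (0 : ℝ)..Real.pi, -(Real.sin θ * Real.sin (x * Real.sin θ))

/-- `J₀''`, obtained by differentiating Bessel's integral twice. -/
def besselJ0Deriv2 (x : ℝ) : ℝ :=
  (1 / Real.pi) * ∫ θ in (0 : ℝ)..Real.pi, -(Real.sin θ ^ 2 * Real.cos (x * Real.sin θ))

theorem hasDerivAt_besselJ0 (x : ℝ) : HasDerivAt besselJ0 (besselJ0Deriv x) x := by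
  refine (intervalIntegral.hasDerivAt_integral_of_dominated_loc_of_deriv_le (bound := fun _ => 1)
    (F := fun x θ => Real.cos (x * Real.sin θ))
    (F' := fun x θ => -(Real.sin θ * Real.sin (x * Real.sin θ))) univ_mem ?_ ?_ ?_ ?_ ?_
    ?_).2.const_mul _
  · exact Eventually.of_forall fun y =>
      (by fun_prop : Continuous fun θ => Real.cos (y * Real.sin θ)).aestronglyMeasurable
  · exact (by fun_prop : Continuous fun θ => Real.cos (x * Real.sin θ)).intervalIntegrable _ _
  · exact (by fun_prop :
      Continuous fun θ => -(Real.sin θ * Real.sin (x * Real.sin θ))).aestronglyMeasurable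
  · refine Eventually.of_forall fun θ _ y _ => ?_
    rw [norm_neg, norm_mul, Real.norm_eq_abs, Real.norm_eq_abs]
    exact mul_le_one₀ (Real.abs_sin_le_one _) (abs_nonneg _) (Real.abs_sin_le_one _)
  · exact intervalIntegrable_const
  · refine Eventually.of_forall fun θ _ y _ => ?_
    have := ((hasDerivAt_id y).mul_const (Real.sin θ)).cos
    convert! this using 1
    simp; ring

theorem hasDerivAt_besselJ0Deriv (x : ℝ) : HasDerivAt besselJ0Deriv (besselJ0Deriv2 x) x := by
  refine (intervalIntegral.hasDerivAt_integral_of_dominated_loc_of_deriv_le (bound := fun _ => 1)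
    (F := fun x θ => -(Real.sin θ * Real.sin (x * Real.sin θ)))
    (F' := fun x θ => -(Real.sin θ ^ 2 * Real.cos (x * Real.sin θ))) univ_mem ?_ ?_ ?_ ?_ ?_
    ?_).2.const_mul _
  · exact Eventually.of_forall fun y => (by fun_prop :
      Continuous fun θ => -(Real.sin θ * Real.sin (y * Real.sin θ))).aestronglyMeasurable
  · exact (by fun_prop :
      Continuous fun θ => -(Real.sin θ * Real.sin (x * Real.sin θ))).intervalIntegrable _ _
  · exact (by fun_prop :
      Continuous fun θ => -(Real.sin θ ^ 2 * Real.cos (x * Real.sin θ))).aestronglyMeasurable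
  · refine Eventually.of_forall fun θ _ y _ => ?_
    rw [norm_neg, norm_mul, norm_pow, Real.norm_eq_abs, Real.norm_eq_abs]
    exact mul_le_one₀ (pow_le_one₀ (abs_nonneg _) (Real.abs_sin_le_one _)) (abs_nonneg _)
      (Real.abs_cos_le_one _)
  · exact intervalIntegrable_const
  · refine Eventually.of_forall fun θ _ y _ => ?_
    have := (((hasDerivAt_id y).mul_const (Real.sin θ)).sin.const_mul (Real.sin θ)).neg
    convert! this using 1
    simp; ring

theorem continuous_besselJ0 : Continuous besselJ0 :=
  continuous_iff_continuousAt.2 fun x => (hasDerivAt_besselJ0 x).continuousAt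

theorem besselJ0_zero : besselJ0 0 = 1 := by
  simp [besselJ0, Real.pi_ne_zero]

theorem besselJ0_neg (x : ℝ) : besselJ0 (-x) = besselJ0 x := by
  simp [besselJ0, neg_mul]

/-- Bessel's equation `x J₀'' + J₀' + x J₀ = 0`: the combination is the integral over `[0, π]` of
the `θ`-derivative of `cos θ sin (x sin θ)`. -/
theorem besselJ0_ode (x : ℝ) :
    x * besselJ0Deriv2 x + besselJ0Deriv x + x * besselJ0 x = 0 := by
  have key : ∫ θ in (0 : ℝ)..Real.pi, (x * -(Real.sin θ ^ 2 * Real.cos (x * Real.sin θ)) +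
      -(Real.sin θ * Real.sin (x * Real.sin θ)) + x * Real.cos (x * Real.sin θ)) = 0 := by
    rw [intervalIntegral.integral_eq_sub_of_hasDerivAt
      (f := fun θ => Real.cos θ * Real.sin (x * Real.sin θ))]
    · simp
    · intro θ _
      convert! (Real.hasDerivAt_cos θ).mul ((Real.hasDerivAt_sin θ).const_mul x).sin using 1
      linear_combination x * Real.cos (x * Real.sin θ) * (Real.sin_sq_add_cos_sq θ).symm
    · exact Continuous.intervalIntegrable (by fun_prop) _ _
  rw [intervalIntegral.integral_add, intervalIntegral.integral_add,
    intervalIntegral.integral_const_mul, intervalIntegral.integral_const_mul] at key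
  · unfold besselJ0Deriv2 besselJ0Deriv besselJ0
    linear_combination (1 / Real.pi) * key
  all_goals exact Continuous.intervalIntegrable (by fun_prop) _ _

/-- The energy `w'² + (1 + 1/(4x²)) w²` of `w = √x J₀(x)`, which solves
`w'' + (1 + 1/(4x²)) w = 0`. -/
def besselEnergy (x : ℝ) : ℝ :=
  x * (besselJ0 x ^ 2 + besselJ0Deriv x ^ 2) + besselJ0 x * besselJ0Deriv x +
    besselJ0 x ^ 2 / (2 * x)

theorem hasDerivAt_besselEnergy {x : ℝ} (hx : 0 < x) :
    HasDerivAt besselEnergy (-(besselJ0 x ^ 2 / (2 * x ^ 2))) x := by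
  have h0 := hasDerivAt_besselJ0 x
  have h1 := hasDerivAt_besselJ0Deriv x
  have h := (((hasDerivAt_id x).mul ((h0.pow 2).add (h1.pow 2))).add (h0.mul h1)).add
    ((h0.pow 2).div ((hasDerivAt_id x).const_mul 2) (by simpa using hx.ne'))
  convert! h using 1
  have hode := besselJ0_ode x
  have e : besselJ0Deriv2 x = -(besselJ0Deriv x + x * besselJ0 x) / x := by
    field_simp; linarith
  simp only [e, id, Nat.cast_ofNat, Pi.add_apply, Pi.pow_apply]
  field_simp
  ring

/-- The energy is antitone and dominates `x J₀(x)²`. -/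
theorem mul_sq_besselJ0_le {x : ℝ} (hx : 1 ≤ x) : x * besselJ0 x ^ 2 ≤ besselEnergy 1 := by
  have hanti : AntitoneOn besselEnergy (Ici 1) := by
    refine antitoneOn_of_deriv_nonpos (convex_Ici 1) ?_ ?_ ?_
    · exact fun y hy => (hasDerivAt_besselEnergy
        (zero_lt_one.trans_le hy)).continuousAt.continuousWithinAt
    · intro y hy
      rw [interior_Ici] at hy
      exact (hasDerivAt_besselEnergy
        (zero_lt_one.trans hy)).differentiableAt.differentiableWithinAt
    · intro y hy
      rw [interior_Ici] at hy
      rw [(hasDerivAt_besselEnergy (zero_lt_one.trans hy)).deriv]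
      exact neg_nonpos.2 (by positivity)
  refine le_trans ?_ (hanti (mem_Ici.2 le_rfl) hx hx)
  have hx0 : 0 < x := by linarith
  have : besselEnergy x - x * besselJ0 x ^ 2 =
      x * (besselJ0Deriv x + besselJ0 x / (2 * x)) ^ 2 + besselJ0 x ^ 2 / (4 * x) := by
    unfold besselEnergy
    field_simp
    ring
  have h2 : 0 ≤ x * (besselJ0Deriv x + besselJ0 x / (2 * x)) ^ 2 + besselJ0 x ^ 2 / (4 * x) := by
    positivity
  linarith

/-- `|J₀(x)|³ = O(x^{-3/2})` is integrable at infinity. -/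
theorem integrableOn_abs_besselJ0_cubed :
    IntegrableOn (fun x => |besselJ0 x| ^ 3) (Ioi 0) := by
  have hc : Continuous fun x => |besselJ0 x| ^ 3 := continuous_besselJ0.abs.pow 3
  rw [← Ioc_union_Ioi_eq_Ioi (zero_le_one' ℝ)]
  refine IntegrableOn.union (hc.integrableOn_Ioc) ?_
  have hE : 0 ≤ besselEnergy 1 := le_trans (by positivity) (mul_sq_besselJ0_le le_rfl)
  refine Integrable.mono' ((integrableOn_Ioi_rpow_of_lt (a := -(3 / 2 : ℝ)) (by norm_num)
    zero_lt_one).const_mul (besselEnergy 1 ^ (3 / 2 : ℝ))) hc.aestronglyMeasurable ?_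
  refine (ae_restrict_iff' measurableSet_Ioi).2 (Eventually.of_forall fun x hx => ?_)
  have hx1 : (1 : ℝ) < x := hx
  have hx0 : 0 < x := by linarith
  rw [Real.norm_of_nonneg (by positivity)]
  have h1 : besselJ0 x ^ 2 ≤ besselEnergy 1 / x := by
    rw [le_div_iff₀ hx0, mul_comm]; exact mul_sq_besselJ0_le hx1.le
  calc |besselJ0 x| ^ 3 = (besselJ0 x ^ 2) ^ (3 / 2 : ℝ) := by
        rw [← sq_abs, ← Real.rpow_natCast, ← Real.rpow_natCast, ← Real.rpow_mul (abs_nonneg _)]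
        norm_num
    _ ≤ (besselEnergy 1 / x) ^ (3 / 2 : ℝ) := Real.rpow_le_rpow (sq_nonneg _) h1 (by norm_num)
    _ = besselEnergy 1 ^ (3 / 2 : ℝ) * x ^ (-(3 / 2 : ℝ)) := by
        rw [Real.div_rpow hE hx0.le, Real.rpow_neg hx0.le, div_eq_mul_inv]

/-! ### The primitive of the cubed Bessel kernel -/

/-- The Volterra kernel `J₀(2Vt)³`. -/
def kernel (V t : ℝ) : ℝ := besselJ0 (2 * V * t) ^ 3

theorem continuous_kernel (V : ℝ) : Continuous (kernel V) :=
  (continuous_besselJ0.comp (by fun_prop)).pow 3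

theorem A_eq (V t : ℝ) : A V t = ∫ r in (0 : ℝ)..t, |kernel V r| := by
  have := intervalIntegral.integral_comp_sub_left (a := 0) (b := t) (fun r => |kernel V r|) t
  simpa [A, kernel, abs_pow] using this

theorem integrableOn_abs_kernel {V : ℝ} (hV : V ≠ 0) :
    IntegrableOn (fun t => |kernel V t|) (Ioi 0) := by
  have h := (integrableOn_Ioi_comp_mul_left_iff (fun x => |besselJ0 x| ^ 3) 0
    (a := 2 * |V|) (by positivity)).2 (by simpa using integrableOn_abs_besselJ0_cubed)
  refine h.congr_fun (fun t _ => ?_) measurableSet_Ioi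
  simp only [kernel, abs_pow]
  rcases abs_cases V with ⟨h, _⟩ | ⟨h, _⟩ <;> rw [h]
  rw [← besselJ0_neg]; ring_nf

theorem kernel_intervalIntegrable (V a b : ℝ) :
    IntervalIntegrable (fun t => |kernel V t|) volume a b :=
  (continuous_kernel V).abs.intervalIntegrable _ _

theorem A_mono (V : ℝ) {s t : ℝ} (hst : s ≤ t) : A V s ≤ A V t := by
  rw [A_eq, A_eq, ← sub_nonneg, intervalIntegral.integral_interval_sub_left
    (kernel_intervalIntegrable ..) (kernel_intervalIntegrable ..)]
  exact intervalIntegral.integral_nonneg hst fun _ _ => abs_nonneg _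

theorem A_zero (V : ℝ) : A V 0 = 0 := by simp [A]

theorem A_nonneg (V : ℝ) {t : ℝ} (ht : 0 ≤ t) : 0 ≤ A V t :=
  (A_zero V).symm.le.trans (A_mono V ht)

theorem continuous_A (V : ℝ) : Continuous (A V) := by
  simp_rw [funext (A_eq V)]
  exact intervalIntegral.continuous_primitive (fun a b => kernel_intervalIntegrable V a b) 0

theorem tendsto_A {V : ℝ} (hV : V ≠ 0) :
    Tendsto (A V) atTop (𝓝 (∫ r in Ioi 0, |kernel V r|)) := by
  simp_rw [funext (A_eq V)]
  exact intervalIntegral_tendsto_integral_Ioi 0 (integrableOn_abs_kernel hV) tendsto_id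

theorem memLp_A {V : ℝ} (hV : V ≠ 0) : MemLp (A V) ⊤ halfLine := by
  refine memLp_top_of_bound (continuous_A V).aestronglyMeasurable
    (∫ r in Ioi 0, |kernel V r|) ?_
  refine (ae_restrict_iff' measurableSet_Ici).2 (Eventually.of_forall fun t ht => ?_)
  rw [Real.norm_of_nonneg (A_nonneg V ht)]
  exact (show Monotone (A V) from fun _ _ h => A_mono V h).ge_of_tendsto (tendsto_A hV) t

/-- The essential supremum dominates `A` pointwise, because `A` is monotone. -/
theorem A_le_normA {V : ℝ} (hV : V ≠ 0) (t : ℝ) : A V t ≤ normA V := by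
  have hae : ∀ᵐ s ∂halfLine, A V s ≤ normA V := by
    filter_upwards [enorm_ae_le_eLpNormEssSup (A V) halfLine] with s hs
    have h := ENNReal.toReal_mono (memLp_A hV).2.ne (by simpa using hs)
    rw [toReal_enorm] at h
    exact (le_abs_self _).trans h
  rw [ae_restrict_iff' measurableSet_Ici] at hae
  obtain ⟨s, hs, hs'⟩ : ∃ s, s ∈ Ioi (max t 0) ∧ (s ∈ Ici (0 : ℝ) → A V s ≤ normA V) := by
    by_contra! hcon
    have : volume (Ioi (max t 0)) = 0 :=
      measure_mono_null (fun s hs => by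
        have := hcon s hs
        simpa using this) (ae_iff.1 hae)
    simp at this
  have hs : max t 0 < s := hs
  exact (A_mono V ((le_max_left _ _).trans hs.le)).trans
    (hs' ((le_max_right _ _).trans hs.le))

theorem normA_pos {V : ℝ} (hV : V ≠ 0) : 0 < normA V := by
  refine lt_of_lt_of_le ?_ (A_le_normA hV 1)
  rw [A_eq]
  refine intervalIntegral.integral_pos zero_lt_one (continuous_kernel V).abs.continuousOn
    (fun _ _ => abs_nonneg _) ⟨0, by simp, ?_⟩
  simp [kernel, besselJ0_zero]

/-! ### The hopping operator on `ℓ²(ℤ³)` -/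

theorem memlp_comp_add (a : Site) (c : EllTwo) : Memℓp (fun n => c (n + a)) 2 := by
  have h := (lp.memℓp c).summable (by norm_num)
  exact memℓp_gen ((Equiv.addRight a).summable_iff.2 h)

/-- Translation `(shift a c)ₙ = cₙ₊ₐ` on `ℓ²(ℤ³)`. -/
def shift (a : Site) : EllTwo →L[ℂ] EllTwo :=
  LinearMap.mkContinuous
    { toFun := fun c => ⟨fun n => c (n + a), memlp_comp_add a c⟩
      map_add' := fun _ _ => rfl
      map_smul' := fun _ _ => rfl } 1 fun c => by
    have h2 : 0 < (2 : ENNReal).toReal := by norm_num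
    rw [one_mul, lp.norm_eq_tsum_rpow h2, lp.norm_eq_tsum_rpow h2]
    exact le_of_eq (congrArg (· ^ _)
      ((Equiv.addRight a).tsum_eq fun n => ‖c n‖ ^ (2 : ENNReal).toReal))

@[simp]
theorem shift_apply (a : Site) (c : EllTwo) (n : Site) : shift a c n = c (n + a) := rfl

/-- The hopping operator `(H c)ₙ = V ∑_{|m-n|₁=1} cₘ`, as a sum of six translations. -/
def hopping (V : ℝ) : EllTwo →L[ℂ] EllTwo :=
  (V : ℂ) • ∑ j : Fin 3, (shift (Pi.single j 1) + shift (Pi.single j (-1)))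

/-- The coupling coefficients as a sum over the six nearest neighbours, which makes the sum in the
equation computable. -/
theorem coupling_eq (V : ℝ) (n m : Site) :
    coupling V n m = ∑ j : Fin 3, ((if m = n + Pi.single j 1 then (V : ℂ) else 0) +
      (if m = n + Pi.single j (-1) then (V : ℂ) else 0)) := by
  have key : ∀ (j : Fin 3) (e : ℤ), m = n + Pi.single j e ↔
      ∀ i, m i - n i = if i = j then e else 0 := by
    intro j e
    rw [funext_iff]
    refine forall_congr' fun i => ?_
    rw [Pi.add_apply, Pi.single_apply]
    constructor <;> intro h <;> linarith
  simp only [key, Fin.forall_fin_succ, Fin.sum_univ_three, coupling, IsEmpty.forall_iff]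
  simp only [Fin.isValue, Fin.succ_zero_eq_one, Fin.succ_one_eq_two, if_true, and_true,
    show (1 : Fin 3) ≠ 0 by decide, show (0 : Fin 3) ≠ 1 by decide, show (2 : Fin 3) ≠ 0 by decide,
    show (0 : Fin 3) ≠ 2 by decide, show (2 : Fin 3) ≠ 1 by decide, show (1 : Fin 3) ≠ 2 by decide,
    if_false]
  have h0 : |n 0 - m 0| = |m 0 - n 0| := abs_sub_comm _ _
  have h1 : |n 1 - m 1| = |m 1 - n 1| := abs_sub_comm _ _
  have h2 : |n 2 - m 2| = |m 2 - n 2| := abs_sub_comm _ _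
  rw [h0, h1, h2]
  generalize m 0 - n 0 = x
  generalize m 1 - n 1 = y
  generalize m 2 - n 2 = z
  by_cases h : |x| + |y| + |z| = 1
  · have : (x = 1 ∧ y = 0 ∧ z = 0) ∨ (x = -1 ∧ y = 0 ∧ z = 0) ∨ (x = 0 ∧ y = 1 ∧ z = 0) ∨
        (x = 0 ∧ y = -1 ∧ z = 0) ∨ (x = 0 ∧ y = 0 ∧ z = 1) ∨ (x = 0 ∧ y = 0 ∧ z = -1) := by
      rcases abs_cases x with hx | hx <;> rcases abs_cases y with hy | hy <;>
        rcases abs_cases z with hz | hz <;> omega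
    rcases this with h | h | h | h | h | h <;> obtain ⟨rfl, rfl, rfl⟩ := h <;> norm_num
  · rw [if_neg h]
    have : ¬(x = 1 ∧ y = 0 ∧ z = 0) ∧ ¬(x = -1 ∧ y = 0 ∧ z = 0) ∧ ¬(x = 0 ∧ y = 1 ∧ z = 0) ∧
        ¬(x = 0 ∧ y = -1 ∧ z = 0) ∧ ¬(x = 0 ∧ y = 0 ∧ z = 1) ∧ ¬(x = 0 ∧ y = 0 ∧ z = -1) := by
      rcases abs_cases x with hx | hx <;> rcases abs_cases y with hy | hy <;>
        rcases abs_cases z with hz | hz <;> omega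
    simp [this]

theorem hopping_apply (V : ℝ) (c : EllTwo) (n : Site) :
    hopping V c n = ∑' m : Site, coupling V n m * c m := by
  have h1 : ∀ a : Site, HasSum (fun m => (if m = n + a then (V : ℂ) else 0) * c m)
      ((V : ℂ) * c (n + a)) := by
    intro a
    convert! hasSum_ite_eq (n + a) ((V : ℂ) * c (n + a)) using 2 with m
    split_ifs with h
    · rw [h]
    · simp
  have h2 : HasSum (fun m => coupling V n m * c m) (∑ j : Fin 3,
      ((V : ℂ) * c (n + Pi.single j 1) + (V : ℂ) * c (n + Pi.single j (-1)))) := by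
    simp_rw [coupling_eq, Finset.sum_mul, add_mul]
    exact hasSum_sum fun j _ => (h1 _).add (h1 _)
  rw [h2.tsum_eq]
  simp only [hopping, Fin.sum_univ_three]
  change (V : ℂ) * ((c (n + _) + c (n + _)) + (c (n + _) + c (n + _)) +
    (c (n + _) + c (n + _))) = _
  ring

/-- The unit vector at the origin. -/
def delta0 : EllTwo := lp.single 2 0 1

theorem delta0_apply (n : Site) : delta0 n = if n = 0 then 1 else 0 := by
  rw [delta0, lp.single_apply]
  split_ifs with h
  · subst h; simp
  · simp [h]

/-- The propagator `e^{-itH}`. -/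
def propagator (V t : ℝ) : EllTwo →L[ℂ] EllTwo :=
  NormedSpace.exp ((-(t * Complex.I)) • hopping V)

theorem propagator_zero (V : ℝ) : propagator V 0 = 1 := by
  simp [propagator]

theorem propagator_add (V s t : ℝ) : propagator V (s + t) = propagator V s * propagator V t := by
  let _ : NormedAlgebra ℚ (EllTwo →L[ℂ] EllTwo) := NormedAlgebra.restrictScalars ℚ ℂ _
  have e : (-((s + t : ℝ) * Complex.I)) • hopping V =
      (-(s * Complex.I)) • hopping V + (-(t * Complex.I)) • hopping V := by
    rw [← add_smul]; congr 1; push_cast; ring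
  rw [propagator, e]
  exact NormedSpace.exp_add_of_commute (((Commute.refl _).smul_left _).smul_right _)

theorem hasDerivAt_neg_mul_I (t : ℝ) :
    HasDerivAt (fun s : ℝ => -(s * Complex.I)) (-Complex.I) t := by
  simpa using ((hasDerivAt_id t).ofReal_comp.mul_const Complex.I).fun_neg

theorem hasDerivAt_propagator (V t : ℝ) :
    HasDerivAt (propagator V) (-Complex.I • (propagator V t * hopping V)) t :=
  HasDerivAt.scomp (g₁ := fun z : ℂ => NormedSpace.exp (z • hopping V)) t
    (hasDerivAt_exp_smul_const (𝕂 := ℂ) (hopping V) (-(t * Complex.I))) (hasDerivAt_neg_mul_I t)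

theorem hasDerivAt_propagator' (V t : ℝ) :
    HasDerivAt (propagator V) (-Complex.I • (hopping V * propagator V t)) t :=
  HasDerivAt.scomp (g₁ := fun z : ℂ => NormedSpace.exp (z • hopping V)) t
    (hasDerivAt_exp_smul_const' (𝕂 := ℂ) (hopping V) (-(t * Complex.I))) (hasDerivAt_neg_mul_I t)

theorem continuous_propagator (V : ℝ) : Continuous (propagator V) :=
  continuous_iff_continuousAt.2 fun t => (hasDerivAt_propagator V t).continuousAt

/-! ### The propagator in Fourier space -/

/-- Normalised Haar measure on `ℝ/ℤ`, the choice made for `UnitAddTorus.mFourierBasis`. -/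
local instance circleMeasureSpace : MeasureSpace UnitAddCircle := ⟨AddCircle.haarAddCircle⟩

local instance : IsProbabilityMeasure (volume : Measure UnitAddCircle) :=
  inferInstanceAs (IsProbabilityMeasure AddCircle.haarAddCircle)

/-- The Fourier coefficients of a continuous function on the torus, as an element of
`ℓ²(ℤ³)`. -/
def fourierMap : C(UnitAddTorus (Fin 3), ℂ) →L[ℂ] EllTwo :=
  (UnitAddTorus.mFourierBasis.repr.toContinuousLinearEquiv.toContinuousLinearMap).comp
    (ContinuousMap.toLp 2 volume ℂ)

theorem fourierMap_apply (g : C(UnitAddTorus (Fin 3), ℂ)) (n : Site) :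
    fourierMap g n = UnitAddTorus.mFourierCoeff g n := by
  rw [← UnitAddTorus.mFourierCoeff_toLp, ← UnitAddTorus.mFourierBasis_repr]
  rfl

theorem fourierMap_one : fourierMap 1 = delta0 := by
  have h := (UnitAddTorus.mFourierBasis (d := Fin 3)).repr_self 0
  rw [UnitAddTorus.coe_mFourierBasis, UnitAddTorus.mFourierLp, UnitAddTorus.mFourier_zero] at h
  exact h

/-- Multiplication by a character is a translation of the Fourier coefficients. -/
theorem fourierMap_mFourier_mul (a : Site) (g : C(UnitAddTorus (Fin 3), ℂ)) :
    fourierMap (UnitAddTorus.mFourier a * g) = shift (-a) (fourierMap g) := by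
  ext n
  rw [shift_apply, fourierMap_apply, fourierMap_apply, UnitAddTorus.mFourierCoeff,
    UnitAddTorus.mFourierCoeff]
  congr 1
  ext x
  rw [show -(n + -a) = -n + a by abel, UnitAddTorus.mFourier_add, ContinuousMap.mul_apply]
  simp only [smul_eq_mul]
  ring

/-- The dispersion relation `2V (cos k₁ + cos k₂ + cos k₃)`, `k = 2πx`, as a sum of
characters. -/
def dispersion (V : ℝ) : C(UnitAddTorus (Fin 3), ℂ) :=
  (V : ℂ) • ∑ j : Fin 3, (UnitAddTorus.mFourier (Pi.single j (-1)) +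
    UnitAddTorus.mFourier (Pi.single j 1))

theorem hopping_fourierMap (V : ℝ) (g : C(UnitAddTorus (Fin 3), ℂ)) :
    hopping V (fourierMap g) = fourierMap (dispersion V * g) := by
  have h1 : dispersion V * g = (V : ℂ) • ∑ j : Fin 3,
      (UnitAddTorus.mFourier (Pi.single j (-1)) * g +
        UnitAddTorus.mFourier (Pi.single j 1) * g) := by
    rw [dispersion, smul_mul_assoc, Finset.sum_mul]
    simp_rw [add_mul]
  have h2 : ∀ (j : Fin 3) (e : ℤ), -(Pi.single j e : Site) = Pi.single j (-e) := by
    intro j e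
    simp [Pi.single_neg]
  rw [h1, map_smul, map_sum]
  simp_rw [map_add, fourierMap_mFourier_mul, h2, neg_neg]
  simp only [hopping, _root_.smul_apply, _root_.sum_apply,
    _root_.add_apply]

theorem smul_hopping_pow_fourierMap (V : ℝ) (z : ℂ) (k : ℕ) :
    ((z • hopping V) ^ k) (fourierMap 1) = fourierMap ((z • dispersion V) ^ k) := by
  induction k with
  | zero => simp
  | succ k ih =>
    rw [pow_succ', mul_apply_eq_comp, ih, _root_.smul_apply,
      hopping_fourierMap, ← map_smul, pow_succ', smul_mul_assoc]

/-- In Fourier space the propagator is multiplication by `exp(-it ε)`. -/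
theorem propagator_delta0 (V t : ℝ) :
    propagator V t delta0 = fourierMap (NormedSpace.exp ((-(t * Complex.I)) • dispersion V)) := by
  rw [propagator, ← fourierMap_one]
  have h1 := (NormedSpace.exp_series_hasSum_exp' (𝕂 := ℂ)
    ((-(t * Complex.I)) • hopping V)).mapL (ContinuousLinearMap.apply ℂ EllTwo (fourierMap 1))
  have h2 := (NormedSpace.exp_series_hasSum_exp' (𝕂 := ℂ)
    ((-(t * Complex.I)) • dispersion V)).mapL fourierMap
  refine h1.unique ?_
  convert! h2 using 2 with k
  rw [map_smul, map_smul]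
  congr 1
  exact smul_hopping_pow_fourierMap V _ k

theorem exp_dispersion_apply (V t : ℝ) (x : Fin 3 → ℝ) :
    (NormedSpace.exp ((-(t * Complex.I)) • dispersion V)) (fun i => (x i : UnitAddCircle)) =
      ∏ i, Complex.exp (-((2 * V * t * Real.cos (2 * Real.pi * x i) : ℝ) * Complex.I)) := by
  have h := NormedSpace.map_exp (ContinuousMap.evalAlgHom ℂ ℂ (fun i => (x i : UnitAddCircle)))
    (ContinuousEvalConst.continuous_eval_const _)
    ((-(t * Complex.I)) • dispersion V)
  rw [← Complex.exp_sum, Complex.exp_eq_exp_ℂ]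
  refine h.trans (congrArg _ ?_)
  have hj : ∀ (j : Fin 3) (e : ℤ), UnitAddTorus.mFourier (Pi.single j e)
      (fun i => (x i : UnitAddCircle)) = Complex.exp (e * (2 * Real.pi * x j) * Complex.I) := by
    intro j e
    rw [UnitAddTorus.mFourier, ContinuousMap.coe_mk, Finset.prod_eq_single j]
    · rw [Pi.single_eq_same, fourier_coe_apply]
      congr 1
      push_cast
      ring
    · intro i _ hi
      rw [Pi.single_eq_of_ne hi, fourier_zero]
    · simp
  simp only [ContinuousMap.evalAlgHom_apply, dispersion, ContinuousMap.smul_apply,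
    ContinuousMap.sum_apply, ContinuousMap.add_apply, hj, smul_eq_mul, Finset.mul_sum]
  refine Finset.sum_congr rfl fun j _ => ?_
  push_cast
  rw [Complex.cos]
  ring_nf

/-- Bessel's integral in exponential form over a full period. -/
theorem integral_exp_cos (z : ℝ) :
    ∫ x in (0 : ℝ)..1, Complex.exp (-((z * Real.cos (2 * Real.pi * x) : ℝ) * Complex.I)) =
      (besselJ0 z : ℂ) := by
  set g : ℝ → ℂ := fun φ => Complex.exp (-((z * Real.sin φ : ℝ) * Complex.I)) with hg
  have hgc : Continuous g := by fun_prop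
  have hgp : Function.Periodic g (2 * Real.pi) := fun φ => by
    simp only [hg, Real.sin_add_two_pi]
  have h1 : ∫ x in (0 : ℝ)..1, Complex.exp (-((z * Real.cos (2 * Real.pi * x) : ℝ) * Complex.I)) =
      (2 * Real.pi)⁻¹ • ∫ φ in (Real.pi / 2)..(Real.pi / 2 + 2 * Real.pi), g φ := by
    have := intervalIntegral.integral_comp_mul_add (a := 0) (b := 1) g
      (c := 2 * Real.pi) (by positivity) (Real.pi / 2)
    simp only [mul_zero, zero_add, mul_one] at this
    rw [add_comm (Real.pi / 2), ← this]
    simp only [hg, Real.sin_add_pi_div_two]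
  have h2 : ∫ φ in (-Real.pi)..0, g φ = ∫ φ in (0 : ℝ)..Real.pi, g (-φ) := by
    rw [intervalIntegral.integral_comp_neg, neg_zero]
  rw [h1, hgp.intervalIntegral_add_eq (Real.pi / 2) (-Real.pi),
    show -Real.pi + 2 * Real.pi = Real.pi by ring,
    ← intervalIntegral.integral_add_adjacent_intervals (b := 0) (hgc.intervalIntegrable _ _)
      (hgc.intervalIntegrable _ _), h2, ← intervalIntegral.integral_add
      ((by fun_prop : Continuous fun φ => g (-φ)).intervalIntegrable _ _)
      (hgc.intervalIntegrable _ _)]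
  have h3 : ∀ φ, g (-φ) + g φ = ((2 * Real.cos (z * Real.sin φ) : ℝ) : ℂ) := by
    intro φ
    simp only [hg, Real.sin_neg]
    push_cast
    rw [Complex.cos]
    ring_nf
  simp_rw [h3]
  rw [intervalIntegral.integral_ofReal, intervalIntegral.integral_const_mul, besselJ0,
    ← Complex.coe_smul, smul_eq_mul, ← Complex.ofReal_mul]
  congr 1
  field_simp

/-- The diagonal matrix element at the origin of the propagator: the integral over the torus
factorises into three copies of Bessel's integral. -/
theorem propagator_delta0_zero (V t : ℝ) :
    propagator V t delta0 0 = (kernel V t : ℂ) := by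
  rw [propagator_delta0, fourierMap_apply, UnitAddTorus.mFourierCoeff_eq_integral _ _ 0]
  simp only [exp_dispersion_apply, neg_zero, UnitAddTorus.mFourier_zero,
    ContinuousMap.one_apply, one_smul, Pi.zero_apply, zero_add]
  have hset : {x : Fin 3 → ℝ | ∀ i, x i ∈ Ioc (0 : ℝ) 1} = univ.pi fun _ => Ioc (0 : ℝ) 1 := by
    ext x; simp
  rw [hset, volume_pi, Measure.restrict_pi_pi, integral_fintype_prod_eq_prod (f := fun _ y =>
    Complex.exp (-((2 * V * t * Real.cos (2 * Real.pi * y) : ℝ) * Complex.I)))]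
  rw [Finset.prod_const, ← intervalIntegral.integral_of_le zero_le_one, integral_exp_cos]
  simp [kernel]

/-! ### Duhamel's formula -/

theorem propagator_hopping (V t : ℝ) (c : EllTwo) :
    propagator V t (hopping V c) = hopping V (propagator V t c) := by
  have h := smul_right_injective _ (neg_ne_zero.2 Complex.I_ne_zero)
    ((hasDerivAt_propagator V t).unique (hasDerivAt_propagator' V t))
  exact congrArg (fun T : EllTwo →L[ℂ] EllTwo => T c) h

theorem propagator_propagator (V s t : ℝ) (c : EllTwo) :
    propagator V s (propagator V t c) = propagator V (s + t) c := by
  rw [propagator_add]; rfl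

theorem hasDerivAt_propagator_apply (V : ℝ) {y : ℝ → EllTwo} {y' : EllTwo} {t : ℝ}
    (hy : HasDerivAt y y' t) :
    HasDerivAt (fun s => propagator V s (y s))
      (-Complex.I • hopping V (propagator V t (y t)) + propagator V t y') t := by
  have h := (ContinuousLinearMap.restrictScalarsL ℂ EllTwo EllTwo ℝ ℝ).hasFDerivAt.comp_hasDerivAt t
    (hasDerivAt_propagator' V t)
  exact h.clm_apply hy

/-- Duhamel's formula `e^{-itH} (δ₀ + iχ ∫₀ᵗ f(s) e^{isH} δ₀ ds)` for the linear equation with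
source `χ f(t) δ₀` and initial value `δ₀`. -/
def duhamel (V χ : ℝ) (f : ℝ → ℂ) (t : ℝ) : EllTwo :=
  propagator V t (delta0 + ∫ s in (0 : ℝ)..t, (Complex.I * χ * f s) • propagator V (-s) delta0)

theorem continuous_propagator_neg_delta0 (V : ℝ) :
    Continuous fun s : ℝ => propagator V (-s) delta0 :=
  ((continuous_propagator V).comp continuous_neg).clm_apply continuous_const

theorem intervalIntegrable_duhamel (V χ : ℝ) {f : ℝ → ℂ} {a b : ℝ}
    (hf : IntervalIntegrable f volume a b) :
    IntervalIntegrable (fun s => (Complex.I * χ * f s) • propagator V (-s) delta0) volume a b :=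
  (hf.const_mul _).smul_continuousOn (continuous_propagator_neg_delta0 V).continuousOn

/-- The coordinate at the origin of Duhamel's formula is the Volterra map. -/
theorem duhamel_apply_zero (V χ : ℝ) (F : ℂ → ℂ) (u : ℝ → ℂ) {t : ℝ}
    (hf : IntervalIntegrable (fun s => F (u s)) volume 0 t) :
    duhamel V χ (fun s => F (u s)) t 0 = volterra V χ F u t := by
  let T : EllTwo →L[ℂ] ℂ := (lp.evalCLM ℂ (fun _ : Site => ℂ) 2 0).comp (propagator V t)
  have hT : ∀ s, T (propagator V (-s) delta0) = (kernel V (t - s) : ℂ) := fun s => by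
    rw [← propagator_delta0_zero, sub_eq_add_neg, ← propagator_propagator]
    rfl
  change T _ = _
  rw [map_add, ← T.intervalIntegral_comp_comm (intervalIntegrable_duhamel V χ hf), volterra,
    ← intervalIntegral.integral_const_mul]
  congr 1
  · have := hT 0
    rwa [neg_zero, propagator_zero, sub_zero] at this
  · congr 1
    ext s
    rw [map_smul, hT, smul_eq_mul, kernel]
    ring

theorem continuousOn_duhamel (V χ : ℝ) {f : ℝ → ℂ}
    (hf : ∀ T : ℝ, 0 ≤ T → IntervalIntegrable f volume 0 T) :
    ContinuousOn (duhamel V χ f) (Ici 0) := by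
  refine (continuous_propagator V).continuousOn.clm_apply (continuousOn_const.add ?_)
  intro t ht
  have ht1 : (0 : ℝ) ≤ t + 1 := by linarith [mem_Ici.1 ht]
  have hc := intervalIntegral.continuousOn_primitive_interval (a := 0) (b := t + 1)
    (f := fun s => (Complex.I * χ * f s) • propagator V (-s) delta0) (μ := volume) (by
      rw [uIcc_of_le ht1]
      exact (intervalIntegrable_iff_integrableOn_Icc_of_le ht1).1
        (intervalIntegrable_duhamel V χ (hf _ ht1)))
  rw [uIcc_of_le ht1] at hc
  refine (hc t ⟨ht, by linarith⟩).mono_of_mem_nhdsWithin ?_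
  rw [← Ici_inter_Iic]
  exact inter_mem_nhdsWithin _ (Iic_mem_nhds (by linarith))

theorem continuousOn_volterra (V χ : ℝ) {F : ℂ → ℂ} {u : ℝ → ℂ}
    (hf : ∀ T : ℝ, 0 ≤ T → IntervalIntegrable (fun s => F (u s)) volume 0 T) :
    ContinuousOn (volterra V χ F u) (Ici 0) :=
  ((lp.evalCLM ℂ (fun _ : Site => ℂ) 2 0).continuous.comp_continuousOn
    (continuousOn_duhamel V χ hf)).congr fun t ht => (duhamel_apply_zero V χ F u (hf t ht)).symm

theorem hasDerivAt_duhamel (V χ : ℝ) {f : ℝ → ℂ} (hf : Continuous f) (t : ℝ) :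
    HasDerivAt (duhamel V χ f)
      (-Complex.I • hopping V (duhamel V χ f t) + (Complex.I * χ * f t) • delta0) t := by
  have hc : Continuous fun s => (Complex.I * χ * f s) • propagator V (-s) delta0 :=
    (continuous_const.mul hf).smul (continuous_propagator_neg_delta0 V)
  have h := hasDerivAt_propagator_apply V ((hc.integral_hasStrictDerivAt 0 t).hasDerivAt.const_add
    delta0)
  rwa [map_smul, propagator_propagator, add_neg_cancel, propagator_zero] at h

theorem duhamel_zero (V χ : ℝ) (f : ℝ → ℂ) : duhamel V χ f 0 = delta0 := by
  simp [duhamel, propagator_zero]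

theorem integral_congr_of_nonneg {E : Type*} [NormedAddCommGroup E] [NormedSpace ℝ E] {f g : ℝ → E}
    (h : ∀ s, 0 ≤ s → f s = g s) {t : ℝ} (ht : 0 ≤ t) :
    ∫ s in (0 : ℝ)..t, f s = ∫ s in (0 : ℝ)..t, g s := by
  refine intervalIntegral.integral_congr fun s hs => ?_
  rw [uIcc_of_le ht] at hs
  exact h s hs.1

theorem volterra_congr {V χ : ℝ} {F : ℂ → ℂ} {u w : ℝ → ℂ} (h : ∀ s, 0 ≤ s → u s = w s) {t : ℝ}
    (ht : 0 ≤ t) : volterra V χ F u t = volterra V χ F w t := by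
  rw [volterra, volterra, integral_congr_of_nonneg (fun s hs => by rw [h s hs]) ht]

/-- A continuous fixed point of the Volterra map generates a solution. -/
theorem isSolution_duhamel {V χ : ℝ} {F : ℂ → ℂ} (hF : Continuous F) {w : ℝ → ℂ}
    (hw : ContinuousOn w (Ici 0)) (hfix : ∀ t, 0 ≤ t → w t = volterra V χ F w t) :
    IsSolution V χ F (duhamel V χ fun s => F (w (max s 0))) := by
  have hwc : Continuous fun s => w (max s 0) :=
    hw.comp_continuous (by fun_prop) fun s => le_max_right s 0
  have hf : Continuous fun s => F (w (max s 0)) := hF.comp hwc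
  have hd := hasDerivAt_duhamel V χ hf
  have h0 : ∀ t, 0 ≤ t → duhamel V χ (fun s => F (w (max s 0))) t 0 = w t := by
    intro t ht
    rw [duhamel_apply_zero V χ F (fun s => w (max s 0)) (hf.intervalIntegrable _ _), hfix t ht]
    exact volterra_congr (fun s hs => by rw [max_eq_left hs]) ht
  refine ⟨fun t _ => (hd t).continuousAt.continuousWithinAt, fun n => ?_, fun t ht n => ?_⟩
  · rw [duhamel_zero, delta0_apply]
  · refine ⟨_, ((lp.evalCLM ℂ (fun _ : Site => ℂ) 2 n).restrictScalars ℝ)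
      |>.hasFDerivAt.comp_hasDerivAt t (hd t) |>.hasDerivWithinAt, ?_⟩
    rw [← hopping_apply]
    change Complex.I * (-Complex.I * hopping V _ n + Complex.I * χ * _ * delta0 n) = _
    rw [delta0_apply, max_eq_left ht]
    split_ifs with hn
    · subst hn
      rw [h0 t ht]
      linear_combination (-(hopping V (duhamel V χ (fun s => F (w (max s 0))) t) 0) +
        χ * F (w t)) * Complex.I_mul_I
    · linear_combination (-(hopping V (duhamel V χ (fun s => F (w (max s 0))) t) n)) *
        Complex.I_mul_I

theorem continuous_source {χ : ℝ} {c : ℝ → EllTwo} {f : ℝ → ℂ} (hc : Continuous c)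
    (hf : Continuous f) :
    Continuous fun s => -Complex.I • c s + (Complex.I * χ * f s) • delta0 := by
  have h1 : Continuous fun s => -Complex.I • c s := hc.const_smul (-Complex.I)
  have h2 : Continuous fun s => (Complex.I * χ * f s) := continuous_const.mul hf
  have h3 : Continuous fun s => (Complex.I * χ * f s) • delta0 := h2.smul continuous_const
  exact h1.add h3

/-- A solution satisfies the integrated equation in `ℓ²`, although the differential equation is
only assumed coordinatewise. -/
theorem IsSolution.eq_integral {V χ : ℝ} {F : ℂ → ℂ} (hF : Continuous F) {C : ℝ → EllTwo}
    (h : IsSolution V χ F C) {t : ℝ} (ht : 0 ≤ t) :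
    C t = delta0 + ∫ s in (0 : ℝ)..t, (-Complex.I • hopping V (C (max s 0)) +
      (Complex.I * χ * F (C (max s 0) 0)) • delta0) := by
  have hC : Continuous fun s => C (max s 0) :=
    h.continuousOn.comp_continuous (by fun_prop) fun s => le_max_right s 0
  have hev : ∀ n : Site, Continuous fun c : EllTwo => c n := fun n =>
    (lp.evalCLM ℂ (fun _ : Site => ℂ) 2 n).continuous
  have hG : Continuous fun s => (-Complex.I • hopping V (C (max s 0)) +
      (Complex.I * χ * F (C (max s 0) 0)) • delta0) := by
    have h1 : Continuous fun s => hopping V (C (max s 0)) := (hopping V).continuous.comp hC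
    have h2 : Continuous fun s => F (C (max s 0) 0) := hF.comp ((hev 0).comp hC)
    exact continuous_source h1 h2
  ext n
  have e : (delta0 + ∫ s in (0 : ℝ)..t, (-Complex.I • hopping V (C (max s 0)) +
      (Complex.I * χ * F (C (max s 0) 0)) • delta0) : EllTwo) n = delta0 n +
      ∫ s in (0 : ℝ)..t, (-Complex.I * hopping V (C (max s 0)) n +
        Complex.I * χ * F (C (max s 0) 0) * delta0 n) := by
    have := (lp.evalCLM ℂ (fun _ : Site => ℂ) 2 n).intervalIntegral_comp_comm
      (hG.intervalIntegrable (μ := volume) 0 t)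
    exact congrArg (delta0 n + ·) this.symm
  rw [e, intervalIntegral.integral_eq_sub_of_hasDerivAt_of_le ht (f := fun s => C s n)
    (fun s hs => ((hev n).comp_continuousOn h.continuousOn).mono Icc_subset_Ici_self s hs)]
  · rw [delta0_apply, h.initial]; ring
  · intro s hs
    obtain ⟨d, hd, hd'⟩ := h.equation s hs.1.le n
    convert! hd.hasDerivAt (Ici_mem_nhds hs.1) using 1
    rw [← hopping_apply] at hd'
    rw [max_eq_left hs.1.le, delta0_apply]
    split_ifs at hd' ⊢ with hn
    · subst hn
      linear_combination Complex.I * hd' - d * Complex.I_mul_I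
    · linear_combination Complex.I * hd' - d * Complex.I_mul_I
  · exact ((hev n).comp hG).intervalIntegrable _ _

/-- The coordinate at the origin of a solution is a fixed point of the Volterra map: the
derivative of `e^{itH} C(t)` contains only the source term. -/
theorem IsSolution.eq_volterra {V χ : ℝ} {F : ℂ → ℂ} (hF : Continuous F) {C : ℝ → EllTwo}
    (h : IsSolution V χ F C) {t : ℝ} (ht : 0 ≤ t) :
    C t 0 = volterra V χ F (fun s => C s 0) t := by
  have hC : Continuous fun s => C (max s 0) :=
    h.continuousOn.comp_continuous (by fun_prop) fun s => le_max_right s 0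
  have hf : Continuous fun s => F (C (max s 0) 0) :=
    hF.comp ((lp.evalCLM ℂ (fun _ : Site => ℂ) 2 0).continuous.comp hC)
  have hG : Continuous fun s => (-Complex.I • hopping V (C (max s 0)) +
      (Complex.I * χ * F (C (max s 0) 0)) • delta0) := by
    have h1 : Continuous fun s => hopping V (C (max s 0)) := (hopping V).continuous.comp hC
    exact continuous_source h1 hf
  -- `y` agrees with `C` on `[0, ∞)` and is differentiable on the whole line.
  set y : ℝ → EllTwo := fun t => delta0 + ∫ s in (0 : ℝ)..t,
    (-Complex.I • hopping V (C (max s 0)) + (Complex.I * χ * F (C (max s 0) 0)) • delta0) with hy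
  have hyC : ∀ s, 0 ≤ s → y s = C s := fun s hs => (h.eq_integral hF hs).symm
  have hyd : ∀ s, HasDerivAt y _ s := fun s =>
    (hG.integral_hasStrictDerivAt 0 s).hasDerivAt.const_add delta0
  have hd : ∀ s ∈ Ioo 0 t, HasDerivAt (fun r => propagator V (-r) (y r))
      ((Complex.I * χ * F (C (max s 0) 0)) • propagator V (-s) delta0) s := by
    intro s hs
    have h1 : HasDerivAt (fun r => y (-r)) (-(-Complex.I • hopping V (C (max s 0)) +
        (Complex.I * χ * F (C (max s 0) 0)) • delta0)) (-s) := by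
      have := (hyd (- -s)).scomp (-s) (hasDerivAt_neg (-s))
      simpa [Function.comp_def, add_comm] using this
    have h2 := (hasDerivAt_propagator_apply V h1).scomp s (hasDerivAt_neg s)
    simp only [Function.comp_def, neg_neg] at h2
    convert! h2 using 1
    rw [hyC s hs.1.le, max_eq_left hs.1.le, map_neg, map_add, map_smul, map_smul,
      propagator_hopping]
    module
  have hint : y 0 = delta0 := by simp [hy]
  have key := intervalIntegral.integral_eq_sub_of_hasDerivAt_of_le ht
    (f := fun r => propagator V (-r) (y r))
    (((continuous_propagator V).comp continuous_neg).clm_apply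
      (continuous_iff_continuousAt.2 fun s => (hyd s).continuousAt)).continuousOn hd
    (intervalIntegrable_duhamel V χ (hf.intervalIntegrable 0 t))
  rw [neg_zero, propagator_zero, hint, hyC t ht] at key
  have hCt : C t = duhamel V χ (fun s => F (C (max s 0) 0)) t := by
    rw [duhamel, key, one_apply_eq_self, add_sub_cancel, propagator_propagator,
      add_neg_cancel, propagator_zero]
    rfl
  rw [hCt, duhamel_apply_zero V χ F (fun s => C (max s 0) 0) (hf.intervalIntegrable 0 t)]
  exact volterra_congr (fun s hs => by rw [max_eq_left hs]) ht

/-! ### Bounds for the Volterra map -/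

theorem abs_besselJ0_le_one (x : ℝ) : |besselJ0 x| ≤ 1 := by
  have h := intervalIntegral.norm_integral_le_of_norm_le_const (a := 0) (b := Real.pi) (C := 1)
    (f := fun θ => Real.cos (x * Real.sin θ)) fun θ _ => Real.abs_cos_le_one _
  rw [sub_zero, one_mul, abs_of_pos Real.pi_pos, Real.norm_eq_abs] at h
  rw [besselJ0, abs_mul, abs_of_pos (by positivity : 0 < 1 / Real.pi), one_div, inv_mul_le_iff₀
    Real.pi_pos, mul_one]
  exact h

theorem abs_kernel_le_one (V t : ℝ) : |kernel V t| ≤ 1 := by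
  rw [kernel, abs_pow]
  exact pow_le_one₀ (abs_nonneg _) (abs_besselJ0_le_one _)

theorem tendsto_besselJ0 : Tendsto besselJ0 atTop (𝓝 0) := by
  have h1 : Tendsto (fun x => Real.sqrt (besselEnergy 1 / x)) atTop (𝓝 0) := by
    have := (tendsto_const_nhds (x := besselEnergy 1)).div_atTop tendsto_id
    simpa [Function.comp_def] using (Real.continuous_sqrt.tendsto 0).comp this
  refine squeeze_zero_norm' ?_ h1
  filter_upwards [eventually_ge_atTop 1] with x hx
  refine Real.abs_le_sqrt ?_
  rw [le_div_iff₀ (by linarith), mul_comm]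
  exact mul_sq_besselJ0_le hx

theorem tendsto_kernel {V : ℝ} (hV : V ≠ 0) : Tendsto (kernel V) atTop (𝓝 0) := by
  have h1 : kernel V = fun t => besselJ0 (2 * |V| * t) ^ 3 := by
    ext t
    rw [kernel]
    rcases abs_cases V with ⟨h, _⟩ | ⟨h, _⟩ <;> rw [h]
    rw [← besselJ0_neg]; ring_nf
  rw [h1]
  have h2 : Tendsto (fun t : ℝ => 2 * |V| * t) atTop atTop :=
    tendsto_id.const_mul_atTop (by positivity)
  simpa using (tendsto_besselJ0.comp h2).pow 3

theorem norm_integral_kernel_mul_le (V : ℝ) {f : ℝ → ℂ} {M a b : ℝ} (t : ℝ) (hab : a ≤ b)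
    (hf : ∀ᵐ s, s ∈ Ioc a b → ‖f s‖ ≤ M) :
    ‖∫ s in a..b, (kernel V (t - s) : ℂ) * f s‖ ≤ M * (A V (t - a) - A V (t - b)) := by
  have hM : ∫ s in a..b, M * |kernel V (t - s)| = M * (A V (t - a) - A V (t - b)) := by
    rw [intervalIntegral.integral_const_mul,
      intervalIntegral.integral_comp_sub_left (fun r => |kernel V r|), A_eq, A_eq,
      intervalIntegral.integral_interval_sub_left (kernel_intervalIntegrable ..)
        (kernel_intervalIntegrable ..)]
  rw [← hM]
  refine intervalIntegral.norm_integral_le_of_norm_le hab ?_ ?_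
  · filter_upwards [hf] with s hs hs'
    rw [norm_mul, Complex.norm_real, Real.norm_eq_abs, mul_comm]
    exact mul_le_mul_of_nonneg_right (hs hs') (abs_nonneg _)
  · exact ((continuous_kernel V).comp (by fun_prop)).abs.const_mul M |>.intervalIntegrable _ _

theorem volterra_eq (V χ : ℝ) (F : ℂ → ℂ) (u : ℝ → ℂ) (t : ℝ) :
    volterra V χ F u t = kernel V t +
      Complex.I * χ * ∫ s in (0 : ℝ)..t, (kernel V (t - s) : ℂ) * F (u s) := rfl

theorem norm_I_mul_mul (χ : ℝ) (z : ℂ) : ‖Complex.I * χ * z‖ = |χ| * ‖z‖ := by simp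

theorem ae_Ioc_of_ae_halfLine {p : ℝ → Prop} (h : ∀ᵐ s ∂halfLine, p s) (t : ℝ) :
    ∀ᵐ s, s ∈ Ioc 0 t → p s := by
  filter_upwards [(ae_restrict_iff' measurableSet_Ici).1 h] with s hs hs'
  exact hs hs'.1.le

theorem ae_halfLine {p : ℝ → Prop} (h : ∀ s, 0 ≤ s → p s) : ∀ᵐ s ∂halfLine, p s :=
  (ae_restrict_iff' measurableSet_Ici).2 (Eventually.of_forall h)

theorem norm_volterra_le {V χ : ℝ} (hV : V ≠ 0) {F : ℂ → ℂ} {u : ℝ → ℂ} {M t : ℝ} (hM : 0 ≤ M)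
    (ht : 0 ≤ t) (hu : ∀ᵐ s, s ∈ Ioc 0 t → ‖F (u s)‖ ≤ M) :
    ‖volterra V χ F u t‖ ≤ 1 + |χ| * normA V * M := by
  have h := norm_integral_kernel_mul_le V t ht hu
  rw [sub_zero, sub_self, A_zero, sub_zero] at h
  rw [volterra_eq]
  refine (norm_add_le _ _).trans (add_le_add ?_ ?_)
  · rw [Complex.norm_real]; exact abs_kernel_le_one V t
  · rw [norm_I_mul_mul, mul_assoc]
    refine mul_le_mul_of_nonneg_left (h.trans ?_) (abs_nonneg _)
    rw [mul_comm]
    exact mul_le_mul_of_nonneg_right (A_le_normA hV t) hM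

theorem intervalIntegrable_of_bounded {f : ℝ → ℂ} {M : ℝ} (hf : AEStronglyMeasurable f halfLine)
    (hM : ∀ᵐ s ∂halfLine, ‖f s‖ ≤ M) {T : ℝ} (hT : 0 ≤ T) :
    IntervalIntegrable f volume 0 T := by
  rw [intervalIntegrable_iff_integrableOn_Ioc_of_le hT]
  have hsub : Ioc 0 T ⊆ Ici (0 : ℝ) := fun s hs => hs.1.le
  exact Integrable.of_bound (hf.mono_measure (Measure.restrict_mono hsub le_rfl)) M
    (ae_restrict_of_ae_restrict_of_subset hsub hM)

theorem volterra_ae_congr {V χ : ℝ} {F : ℂ → ℂ} {u w : ℝ → ℂ} (h : u =ᵐ[halfLine] w) {t : ℝ}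
    (ht : 0 ≤ t) : volterra V χ F u t = volterra V χ F w t := by
  rw [volterra_eq, volterra_eq, intervalIntegral.integral_congr_ae]
  filter_upwards [ae_Ioc_of_ae_halfLine h t] with s hs hs'
  rw [uIoc_of_le ht] at hs'
  rw [hs hs']

/-- Constants for which the Volterra map is a contraction of the ball of radius `R` in `L^∞`:
`F` is `L`-Lipschitz and bounded by `M` on the disc of radius `R`, where `|χ| L ‖A‖_∞ < 1` and
`1 + |χ| ‖A‖_∞ M < R`. -/
structure Admissible (V χ : ℝ) (F : ℂ → ℂ) (R L M : ℝ) : Prop where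
  ne_zero : V ≠ 0
  continuous : Continuous F
  map_zero : F 0 = 0
  lipschitz_nonneg : 0 ≤ L
  lipschitz : ∀ z w, ‖z‖ ≤ R → ‖w‖ ≤ R → ‖F z - F w‖ ≤ L * ‖z - w‖
  bound_nonneg : 0 ≤ M
  bound : ∀ z, ‖z‖ ≤ R → ‖F z‖ ≤ M
  contracting : |χ| * (L * normA V) < 1
  invariant : 1 + |χ| * normA V * M < R

namespace Admissible

variable {V χ : ℝ} {F : ℂ → ℂ} {R L M : ℝ}

theorem one_lt_radius (h : Admissible V χ F R L M) : 1 < R := by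
  have h1 := h.bound_nonneg
  have h2 := (normA_pos h.ne_zero).le
  have h3 : 0 ≤ |χ| * normA V * M := by positivity
  linarith [h.invariant]

theorem norm_le_mul (h : Admissible V χ F R L M) {z : ℂ} (hz : ‖z‖ ≤ R) : ‖F z‖ ≤ L * ‖z‖ := by
  simpa [h.map_zero] using
    h.lipschitz z 0 hz (by simpa using (zero_lt_one.trans h.one_lt_radius).le)

theorem ae_norm_le (u : LInfty) : ∀ᵐ s ∂halfLine, ‖u s‖ ≤ ‖u‖ := by
  filter_upwards [enorm_ae_le_eLpNormEssSup u halfLine] with s hs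
  have h1 := ENNReal.toReal_mono (Lp.eLpNorm_ne_top u) (by simpa using hs)
  rwa [toReal_enorm] at h1

theorem norm_le_of_ae {u : LInfty} {K : ℝ} (hK : 0 ≤ K) (h : ∀ᵐ s ∂halfLine, ‖u s‖ ≤ K) :
    ‖u‖ ≤ K := by
  rw [Lp.norm_def]
  refine ENNReal.toReal_le_of_le_ofReal hK ?_
  rw [eLpNorm_exponent_top]
  exact eLpNormEssSup_le_of_ae_bound h

theorem ae_le_radius (u : Ball R) : ∀ᵐ s ∂halfLine, ‖(u : LInfty) s‖ ≤ R := by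
  filter_upwards [ae_norm_le (u : LInfty)] with s hs
  exact hs.trans (mem_closedBall_zero_iff.1 u.2)

theorem intervalIntegrable_comp (h : Admissible V χ F R L M) (u : Ball R) {T : ℝ} (hT : 0 ≤ T) :
    IntervalIntegrable (fun s => F ((u : LInfty) s)) volume 0 T := by
  refine intervalIntegrable_of_bounded (M := M)
    (h.continuous.comp_aestronglyMeasurable (Lp.aestronglyMeasurable _)) ?_ hT
  filter_upwards [ae_le_radius u] with s hs using h.bound _ hs

theorem norm_volterra_lt (h : Admissible V χ F R L M) {u : ℝ → ℂ} {t : ℝ} (ht : 0 ≤ t)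
    (hu : ∀ᵐ s, s ∈ Ioc 0 t → ‖u s‖ ≤ R) : ‖volterra V χ F u t‖ < R := by
  refine (norm_volterra_le h.ne_zero h.bound_nonneg ht ?_).trans_lt h.invariant
  filter_upwards [hu] with s hs hs' using h.bound _ (hs hs')

theorem memLp_volterra (h : Admissible V χ F R L M) (u : Ball R) :
    MemLp (volterra V χ F (u : LInfty)) ⊤ halfLine := by
  refine memLp_top_of_bound ((continuousOn_volterra V χ fun T hT =>
    h.intervalIntegrable_comp u hT).aestronglyMeasurable measurableSet_Ici) R ?_
  exact ae_halfLine fun t ht =>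
    (h.norm_volterra_lt ht (ae_Ioc_of_ae_halfLine (ae_le_radius u) t)).le

/-- The Volterra map on the ball of radius `R` in `L^∞([0,∞))`. -/
def ballMap (h : Admissible V χ F R L M) (u : Ball R) : Ball R :=
  ⟨(h.memLp_volterra u).toLp _, by
    rw [mem_closedBall_zero_iff]
    refine norm_le_of_ae (zero_lt_one.trans h.one_lt_radius).le ?_
    filter_upwards [(h.memLp_volterra u).coeFn_toLp, ae_halfLine fun t ht =>
      (h.norm_volterra_lt ht (ae_Ioc_of_ae_halfLine (ae_le_radius u) t)).le] with t h1 h2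
    rwa [h1]⟩

theorem coeFn_ballMap (h : Admissible V χ F R L M) (u : Ball R) :
    ((h.ballMap u : LInfty) : ℝ → ℂ) =ᵐ[halfLine] volterra V χ F (u : LInfty) :=
  (h.memLp_volterra u).coeFn_toLp

theorem norm_volterra_sub_le (h : Admissible V χ F R L M) (u v : Ball R) {t : ℝ} (ht : 0 ≤ t) :
    ‖volterra V χ F (u : LInfty) t - volterra V χ F (v : LInfty) t‖ ≤
      |χ| * (L * normA V) * ‖(u - v : LInfty)‖ := by
  have hk : Continuous fun s => (kernel V (t - s) : ℂ) :=
    Complex.continuous_ofReal.comp ((continuous_kernel V).comp (by fun_prop))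
  have hi : ∀ w : Ball R, IntervalIntegrable
      (fun s => (kernel V (t - s) : ℂ) * F ((w : LInfty) s)) volume 0 t := fun w =>
    (h.intervalIntegrable_comp w ht).continuousOn_mul hk.continuousOn
  rw [volterra_eq, volterra_eq, add_sub_add_left_eq_sub, ← mul_sub,
    ← intervalIntegral.integral_sub (hi u) (hi v)]
  simp_rw [← mul_sub]
  have hae : ∀ᵐ s ∂halfLine, ‖F ((u : LInfty) s) - F ((v : LInfty) s)‖ ≤
      L * ‖(u - v : LInfty)‖ := by
    filter_upwards [ae_le_radius u, ae_le_radius v, ae_norm_le (u - v : LInfty),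
      Lp.coeFn_sub (u : LInfty) (v : LInfty)] with s hu hv huv hs
    rw [hs] at huv
    exact (h.lipschitz _ _ hu hv).trans (mul_le_mul_of_nonneg_left huv h.lipschitz_nonneg)
  have := norm_integral_kernel_mul_le V t ht (ae_Ioc_of_ae_halfLine hae t)
  rw [sub_zero, sub_self, A_zero, sub_zero] at this
  rw [norm_I_mul_mul, mul_assoc]
  refine mul_le_mul_of_nonneg_left (this.trans ?_) (abs_nonneg _)
  rw [mul_right_comm]
  exact mul_le_mul_of_nonneg_right (mul_le_mul_of_nonneg_left (A_le_normA h.ne_zero t)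
    h.lipschitz_nonneg) (norm_nonneg _)

theorem contractingWith_ballMap (h : Admissible V χ F R L M) :
    ContractingWith (Real.toNNReal (|χ| * (L * normA V))) h.ballMap := by
  have h0 : 0 ≤ |χ| * (L * normA V) :=
    mul_nonneg (abs_nonneg _) (mul_nonneg h.lipschitz_nonneg (normA_pos h.ne_zero).le)
  refine ⟨Real.toNNReal_lt_one.2 h.contracting, LipschitzWith.of_dist_le_mul fun u v => ?_⟩
  rw [Real.coe_toNNReal _ h0, Subtype.dist_eq, Subtype.dist_eq, dist_eq_norm, dist_eq_norm]
  refine norm_le_of_ae (mul_nonneg h0 (norm_nonneg _)) ?_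
  filter_upwards [h.coeFn_ballMap u, h.coeFn_ballMap v,
    Lp.coeFn_sub (h.ballMap u : LInfty) (h.ballMap v : LInfty),
    ae_halfLine fun t ht => h.norm_volterra_sub_le u v ht] with t hu hv huv ht
  rwa [huv, Pi.sub_apply, hu, hv]

/-! ### Solutions -/

/-- A continuous fixed point of the Volterra map stays inside the disc of radius `R`: at a first
exit time the bound for the Volterra map would give `|w| < R`. -/
theorem norm_lt_radius (h : Admissible V χ F R L M) {w : ℝ → ℂ} (hw : ContinuousOn w (Ici 0))
    (hfix : ∀ t, 0 ≤ t → w t = volterra V χ F w t) {t : ℝ} (ht : 0 ≤ t) : ‖w t‖ < R := by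
  by_contra! hcon
  set S : Set ℝ := Ici 0 ∩ (fun s => ‖w s‖) ⁻¹' Ici R with hS
  have hcl : IsClosed S := hw.norm.preimage_isClosed_of_isClosed isClosed_Ici isClosed_Ici
  have hbd : BddBelow S := ⟨0, fun s hs => hs.1⟩
  have hmem : sInf S ∈ S := hcl.csInf_mem ⟨t, ht, hcon⟩ hbd
  refine absurd (show R ≤ ‖w (sInf S)‖ from hmem.2) (not_le.2 ?_)
  rw [hfix _ hmem.1]
  refine h.norm_volterra_lt hmem.1 ?_
  filter_upwards [Measure.ae_ne volume (sInf S)] with s hs hs'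
  by_contra! hR
  exact hs (le_antisymm hs'.2 (csInf_le hbd ⟨hs'.1.le, hR.le⟩))

/-- One step of the decay estimate: in the Volterra integral the contribution of times `s ≤ T` is
at most `M (A(t) - A(t - T))`, which tends to `0`, and the rest is at most `|χ| L ‖A‖_∞ a`. -/
theorem eventually_norm_le (h : Admissible V χ F R L M) {w : ℝ → ℂ} (hw : ContinuousOn w (Ici 0))
    (hfix : ∀ t, 0 ≤ t → w t = volterra V χ F w t) {a p : ℝ} (ha : 0 < a)
    (hp : |χ| * (L * normA V) < p) (hwa : ∀ᶠ t in atTop, ‖w t‖ ≤ a) :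
    ∀ᶠ t in atTop, ‖w t‖ ≤ p * a := by
  obtain ⟨T, hT⟩ := eventually_atTop.1 (hwa.and (eventually_ge_atTop 0))
  have hT0 : 0 ≤ T := (hT T le_rfl).2
  have hR := fun s (hs : 0 ≤ s) => (h.norm_lt_radius hw hfix hs).le
  have hsub : Tendsto (fun t : ℝ => t - T) atTop atTop :=
    tendsto_atTop_add_const_right _ _ tendsto_id
  have hlim : Tendsto (fun t => |kernel V t| + |χ| * (M * (A V t - A V (t - T)))) atTop (𝓝 0) := by
    have h1 := (tendsto_kernel h.ne_zero).abs
    have h2 := (tendsto_A h.ne_zero).sub ((tendsto_A h.ne_zero).comp hsub)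
    simpa using h1.add ((h2.const_mul M).const_mul |χ|)
  have hpos : 0 < (p - |χ| * (L * normA V)) * a := mul_pos (sub_pos.2 hp) ha
  filter_upwards [hlim.eventually_lt_const hpos, eventually_ge_atTop T] with t hlt hTt
  have ht : 0 ≤ t := hT0.trans hTt
  have hFw : ContinuousOn (fun s => F (w s)) (Ici 0) := h.continuous.comp_continuousOn hw
  have hk : Continuous fun s => (kernel V (t - s) : ℂ) :=
    Complex.continuous_ofReal.comp ((continuous_kernel V).comp (by fun_prop))
  have hi : ∀ b c, 0 ≤ b → b ≤ c → IntervalIntegrable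
      (fun s => (kernel V (t - s) : ℂ) * F (w s)) volume b c := fun b c hb hbc => by
    refine ContinuousOn.intervalIntegrable (hk.continuousOn.mul (hFw.mono ?_))
    rw [uIcc_of_le hbc]
    exact fun s hs => hb.trans hs.1
  have e1 := norm_integral_kernel_mul_le V (f := fun s => F (w s)) (M := M) t hT0
    (Eventually.of_forall fun s hs => h.bound _ (hR s hs.1.le))
  have e2 := norm_integral_kernel_mul_le V (f := fun s => F (w s)) (M := L * a) t hTt
    (Eventually.of_forall fun s hs => (h.norm_le_mul (hR s (hT0.trans hs.1.le))).trans
      (mul_le_mul_of_nonneg_left (hT s hs.1.le).1 h.lipschitz_nonneg))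
  rw [sub_self, A_zero, sub_zero] at e2
  rw [sub_zero] at e1
  have e3 : L * a * A V (t - T) ≤ L * a * normA V :=
    mul_le_mul_of_nonneg_left (A_le_normA h.ne_zero _) (mul_nonneg h.lipschitz_nonneg ha.le)
  rw [hfix t ht, volterra_eq,
    ← intervalIntegral.integral_add_adjacent_intervals (hi 0 T le_rfl hT0) (hi T t hT0 hTt)]
  refine (norm_add_le _ _).trans ?_
  rw [norm_I_mul_mul, Complex.norm_real, Real.norm_eq_abs]
  have e4 := mul_le_mul_of_nonneg_left
    ((norm_add_le _ _).trans (add_le_add e1 (e2.trans e3))) (abs_nonneg χ)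
  calc _ ≤ |kernel V t| + |χ| * (M * (A V t - A V (t - T)) + L * a * normA V) := by gcongr
    _ ≤ p * a := by linarith

/-- Iterating the decay step gives `|w| ≤ R pⁿ` eventually, for every `n` and a fixed `p < 1`. -/
theorem tendsto_norm_zero (h : Admissible V χ F R L M) {w : ℝ → ℂ} (hw : ContinuousOn w (Ici 0))
    (hfix : ∀ t, 0 ≤ t → w t = volterra V χ F w t) :
    Tendsto (fun t => ‖w t‖) atTop (𝓝 0) := by
  obtain ⟨p, hp, hp1⟩ := exists_between h.contracting
  have hp0 : 0 < p := lt_of_le_of_lt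
    (mul_nonneg (abs_nonneg _) (mul_nonneg h.lipschitz_nonneg (normA_pos h.ne_zero).le)) hp
  have hR : 0 < R := zero_lt_one.trans h.one_lt_radius
  have hn : ∀ n : ℕ, ∀ᶠ t in atTop, ‖w t‖ ≤ p ^ n * R := by
    intro n
    induction n with
    | zero =>
      filter_upwards [eventually_ge_atTop 0] with t ht
      simpa using (h.norm_lt_radius hw hfix ht).le
    | succ n ih =>
      simpa [pow_succ', mul_assoc] using
        h.eventually_norm_le hw hfix (mul_pos (pow_pos hp0 n) hR) hp ih
  have hlim : Tendsto (fun n : ℕ => p ^ n * R) atTop (𝓝 0) := by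
    simpa using (tendsto_pow_atTop_nhds_zero_of_lt_one hp0.le hp1).mul_const R
  rw [Metric.tendsto_nhds]
  intro ε hε
  obtain ⟨n, hnε⟩ := (hlim.eventually_lt_const hε).exists
  filter_upwards [hn n] with t ht
  simpa using ht.trans_lt hnε

theorem continuousOn_apply_zero {C : ℝ → EllTwo} (hC : IsSolution V χ F C) :
    ContinuousOn (fun t => C t 0) (Ici 0) :=
  (lp.evalCLM ℂ (fun _ : Site => ℂ) 2 0).continuous.comp_continuousOn hC.continuousOn

/-- Fixed point, existence, Volterra equation and decay for an admissible nonlinearity. Existence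
comes from the fixed point, whose representative `volterra V χ F u₀` is continuous. -/
theorem main (h : Admissible V χ F R L M) :
    (∃ Φ : Ball R → Ball R,
      (∀ u, ((Φ u : LInfty) : ℝ → ℂ) =ᵐ[halfLine] volterra V χ F ((u : LInfty) : ℝ → ℂ)) ∧
      ContractingWith (Real.toNNReal (|χ| * (L * normA V))) Φ ∧
      ∃ u₀, Function.fixedPoints Φ = {u₀} ∧ ∀ C, IsSolution V χ F C →
        ((u₀ : LInfty) : ℝ → ℂ) =ᵐ[halfLine] fun t => C t 0) ∧
    (∃ C, IsSolution V χ F C) ∧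
    (∀ C, IsSolution V χ F C →
      (∀ t : ℝ, 0 ≤ t → C t 0 = volterra V χ F (fun s => C s 0) t) ∧
      Tendsto (fun t => ‖C t 0‖) atTop (𝓝 0)) := by
  have hR : 0 ≤ R := (zero_lt_one.trans h.one_lt_radius).le
  have : Nonempty (Ball R) := ⟨⟨0, by simpa using hR⟩⟩
  have : CompleteSpace (Ball R) := Metric.isClosed_closedBall.completeSpace_coe
  set u₀ : Ball R := h.contractingWith_ballMap.fixedPoint with hu₀
  have hfix₀ : h.ballMap u₀ = u₀ := h.contractingWith_ballMap.fixedPoint_isFixedPt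
  refine ⟨⟨h.ballMap, h.coeFn_ballMap, h.contractingWith_ballMap, u₀, ?_, fun C hC => ?_⟩, ?_,
    fun C hC => ⟨fun t ht => hC.eq_volterra h.continuous ht, ?_⟩⟩
  · ext u
    rw [mem_singleton_iff]
    constructor
    · intro hu
      exact h.contractingWith_ballMap.fixedPoint_unique hu
    · rintro rfl
      exact hfix₀
  · -- The origin component of `C` defines an element of the ball fixed by `ballMap`.
    have hc := continuousOn_apply_zero hC
    have hfix := fun t (ht : 0 ≤ t) => hC.eq_volterra h.continuous ht
    have hlt : ∀ᵐ t ∂halfLine, ‖C t 0‖ ≤ R :=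
      ae_halfLine fun t ht => (h.norm_lt_radius hc hfix ht).le
    have hmem : MemLp (fun t => C t 0) ⊤ halfLine :=
      memLp_top_of_bound (hc.aestronglyMeasurable measurableSet_Ici) R hlt
    have hball : hmem.toLp _ ∈ Metric.closedBall (0 : LInfty) R := by
      rw [mem_closedBall_zero_iff]
      refine norm_le_of_ae hR ?_
      filter_upwards [hmem.coeFn_toLp, hlt] with t h1 h2
      rwa [h1]
    have hfp : h.ballMap ⟨hmem.toLp _, hball⟩ = ⟨hmem.toLp _, hball⟩ := by
      refine Subtype.ext (Lp.ext ?_)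
      filter_upwards [h.coeFn_ballMap ⟨hmem.toLp _, hball⟩, hmem.coeFn_toLp,
        ae_halfLine (p := fun t => volterra V χ F (hmem.toLp _ : LInfty) t = C t 0) fun t ht => by
          rw [hfix t ht]
          exact volterra_ae_congr hmem.coeFn_toLp ht] with t h1 h2 h3
      rw [h1, h2, h3]
    rw [hu₀, ← h.contractingWith_ballMap.fixedPoint_unique hfp]
    exact hmem.coeFn_toLp
  · have hae := h.coeFn_ballMap u₀
    rw [hfix₀] at hae
    exact ⟨_, isSolution_duhamel h.continuous
      (continuousOn_volterra V χ fun T hT => h.intervalIntegrable_comp u₀ hT)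
      fun t ht => volterra_ae_congr hae ht⟩
  · exact h.tendsto_norm_zero (continuousOn_apply_zero hC)
      fun t ht => hC.eq_volterra h.continuous ht

end Admissible

/-! ### The two nonlinearities -/

theorem norm_sub_sq_eq (z w : ℂ) :
    ‖z - w‖ ^ 2 = (‖z‖ - ‖w‖) ^ 2 + 2 * (‖z‖ * ‖w‖ - (z * (starRingEnd ℂ) w).re) := by
  simp only [← Complex.normSq_eq_norm_sq, sub_sq]
  rw [Complex.normSq_sub]
  ring

theorem re_mul_conj_le (z w : ℂ) : (z * (starRingEnd ℂ) w).re ≤ ‖z‖ * ‖w‖ := by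
  simpa using Complex.re_le_norm (z * (starRingEnd ℂ) w)

/-- A radial map `z ↦ φ(|z|) z` is `L`-Lipschitz as soon as its profile `r ↦ φ(r) r` is and
`0 ≤ φ ≤ L`: by the law of cosines the angular part of `|z - w|²` is scaled by
`φ(|z|) φ(|w|) ≤ L²`. -/
theorem norm_radial_sub_le {φ : ℝ → ℝ} {L : ℝ} (z w : ℂ) (hL : 0 ≤ L) (hz0 : 0 ≤ φ ‖z‖)
    (hw0 : 0 ≤ φ ‖w‖) (hz : φ ‖z‖ ≤ L) (hw : φ ‖w‖ ≤ L)
    (hφ : |φ ‖z‖ * ‖z‖ - φ ‖w‖ * ‖w‖| ≤ L * |‖z‖ - ‖w‖|) :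
    ‖(φ ‖z‖ : ℂ) * z - (φ ‖w‖ : ℂ) * w‖ ≤ L * ‖z - w‖ := by
  refine le_of_sq_le_sq ?_ (mul_nonneg hL (norm_nonneg _))
  rw [mul_pow, norm_sub_sq_eq, norm_sub_sq_eq z w]
  have e : ((φ ‖z‖ : ℂ) * z * (starRingEnd ℂ) ((φ ‖w‖ : ℂ) * w)).re =
      φ ‖z‖ * φ ‖w‖ * (z * (starRingEnd ℂ) w).re := by
    rw [map_mul, Complex.conj_ofReal, ← Complex.re_ofReal_mul]
    congr 1
    push_cast
    ring
  rw [e, norm_mul, norm_mul, Complex.norm_real, Complex.norm_real, Real.norm_of_nonneg hz0,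
    Real.norm_of_nonneg hw0]
  have h1 : (φ ‖z‖ * ‖z‖ - φ ‖w‖ * ‖w‖) ^ 2 ≤ L ^ 2 * (‖z‖ - ‖w‖) ^ 2 := by
    rw [← sq_abs, ← sq_abs (‖z‖ - ‖w‖), ← mul_pow]
    exact pow_le_pow_left₀ (abs_nonneg _) hφ 2
  have h2 : φ ‖z‖ * φ ‖w‖ * (‖z‖ * ‖w‖ - (z * (starRingEnd ℂ) w).re) ≤
      L * L * (‖z‖ * ‖w‖ - (z * (starRingEnd ℂ) w).re) :=
    mul_le_mul_of_nonneg_right (mul_le_mul hz hw hw0 hL) (sub_nonneg.2 (re_mul_conj_le z w))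
  linarith

theorem norm_powerF (σ : ℝ) (z : ℂ) : ‖powerF σ z‖ = ‖z‖ ^ (2 * σ) * ‖z‖ := by
  rw [powerF, norm_mul, Complex.norm_real, Real.norm_of_nonneg (by positivity)]

theorem continuous_powerF {σ : ℝ} (hσ : 0 < σ) : Continuous (powerF σ) :=
  (Complex.continuous_ofReal.comp
    (continuous_norm.rpow_const fun _ => Or.inr (by positivity))).mul continuous_id

theorem abs_rpow_mul_sub_le {p R a b : ℝ} (hp : 0 < p) (ha : 0 ≤ a) (haR : a ≤ R) (hb : 0 ≤ b)
    (hbR : b ≤ R) : |a ^ p * a - b ^ p * b| ≤ (1 + p) * R ^ p * |a - b| := by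
  have hder : ∀ x : ℝ, HasDerivAt (fun x : ℝ => x ^ (1 + p)) ((1 + p) * x ^ p) x := fun x => by
    simpa using Real.hasDerivAt_rpow_const (x := x) (p := 1 + p) (Or.inr (by linarith))
  have h := (convex_Icc 0 R).norm_image_sub_le_of_norm_hasDerivWithin_le (C := (1 + p) * R ^ p)
    (fun x _ => (hder x).hasDerivWithinAt) (fun x hx => by
      rw [Real.norm_of_nonneg (mul_nonneg (by linarith) (Real.rpow_nonneg hx.1 _))]
      exact mul_le_mul_of_nonneg_left (Real.rpow_le_rpow hx.1 hx.2 hp.le) (by linarith))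
    ⟨hb, hbR⟩ ⟨ha, haR⟩
  have e : ∀ x : ℝ, 0 ≤ x → x ^ (1 + p) = x ^ p * x := fun x hx => by
    rw [add_comm, Real.rpow_add_one' hx (by linarith)]
  simpa [e a ha, e b hb] using h

theorem norm_powerF_sub_le {σ R : ℝ} (hσ : 0 < σ) {z w : ℂ} (hz : ‖z‖ ≤ R) (hw : ‖w‖ ≤ R) :
    ‖powerF σ z - powerF σ w‖ ≤ (1 + 2 * σ) * R ^ (2 * σ) * ‖z - w‖ := by
  have hR : 0 ≤ R := (norm_nonneg z).trans hz
  have hp : 0 < 2 * σ := by linarith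
  have hle : ∀ r : ℝ, 0 ≤ r → r ≤ R → r ^ (2 * σ) ≤ (1 + 2 * σ) * R ^ (2 * σ) := fun r h0 h1 =>
    (Real.rpow_le_rpow h0 h1 hp.le).trans
      (le_mul_of_one_le_left (Real.rpow_nonneg hR _) (by linarith))
  exact norm_radial_sub_le (φ := fun r => r ^ (2 * σ)) z w
    (mul_nonneg (by linarith) (Real.rpow_nonneg hR _)) (by positivity) (by positivity)
    (hle _ (norm_nonneg _) hz) (hle _ (norm_nonneg _) hw)
    (abs_rpow_mul_sub_le hp (norm_nonneg _) hz (norm_nonneg _) hw)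

theorem admissible_powerF {V σ χ : ℝ} (hV : V ≠ 0) (hσ : 0 < σ) (hχ : |χ| < chiPower V σ) :
    Admissible V χ (powerF σ) (1 + 1 / (2 * σ))
      ((1 + 2 * σ) * (1 + 1 / (2 * σ)) ^ (2 * σ))
      ((1 + 1 / (2 * σ)) ^ (2 * σ) * (1 + 1 / (2 * σ))) := by
  have hN := normA_pos hV
  have hR : 0 < 1 + 1 / (2 * σ) := by positivity
  have hcrit : |χ| * ((1 + 2 * σ) * (1 + 1 / (2 * σ)) ^ (2 * σ) * normA V) < 1 := by
    rwa [chiPower, lt_div_iff₀ (by positivity)] at hχ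
  refine ⟨hV, continuous_powerF hσ, by simp [powerF], by positivity,
    fun z w hz hw => norm_powerF_sub_le hσ hz hw, by positivity, fun z hz => ?_, hcrit, ?_⟩
  · rw [norm_powerF]
    exact mul_le_mul (Real.rpow_le_rpow (norm_nonneg _) hz (by linarith)) hz (norm_nonneg _)
      (by positivity)
  · -- `R = 1 + 1/(2σ)` satisfies `R = (1 + 2σ)/(2σ)`, so that `L R = (1 + 2σ) M`.
    have e : |χ| * normA V * ((1 + 1 / (2 * σ)) ^ (2 * σ) * (1 + 1 / (2 * σ))) =
        |χ| * ((1 + 2 * σ) * (1 + 1 / (2 * σ)) ^ (2 * σ) * normA V) * (1 / (2 * σ)) := by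
      generalize (1 + 1 / (2 * σ)) ^ (2 * σ) = P
      field_simp
      ring
    rw [e]
    have := mul_lt_mul_of_pos_right hcrit (show 0 < 1 / (2 * σ) by positivity)
    linarith

theorem continuous_saturableF : Continuous saturableF := by
  have h : Continuous fun z : ℂ => ‖z‖ ^ 2 / (1 + ‖z‖ ^ 2) :=
    Continuous.div (by fun_prop) (by fun_prop) fun _ => by positivity
  exact (Complex.continuous_ofReal.comp h).mul continuous_id

/-- The derivative `(r⁴ + 3r²)/(1 + r²)²` of the saturable profile is at most `9/8`, attained at
`r² = 3`. -/
theorem abs_saturable_profile_sub_le (a b : ℝ) :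
    |a ^ 2 / (1 + a ^ 2) * a - b ^ 2 / (1 + b ^ 2) * b| ≤ 9 / 8 * |a - b| := by
  have hder : ∀ x : ℝ, HasDerivAt (fun x : ℝ => x ^ 2 / (1 + x ^ 2) * x)
      ((x ^ 4 + 3 * x ^ 2) / (1 + x ^ 2) ^ 2) x := fun x => by
    have hx : 1 + x ^ 2 ≠ 0 := by positivity
    convert! (((hasDerivAt_id x).pow 2).div (((hasDerivAt_id x).pow 2).const_add 1) hx).mul
      (hasDerivAt_id x) using 1
    simp
    field_simp
    ring
  have h := convex_univ.norm_image_sub_le_of_norm_hasDerivWithin_le (C := 9 / 8)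
    (fun x _ => (hder x).hasDerivWithinAt) (fun x _ => by
      rw [Real.norm_of_nonneg (by positivity), div_le_iff₀ (by positivity)]
      nlinarith [sq_nonneg (x ^ 2 - 3)])
    (mem_univ b) (mem_univ a)
  simpa using h

theorem saturable_ratio_le_one (r : ℝ) : r ^ 2 / (1 + r ^ 2) ≤ 1 := by
  rw [div_le_one (by positivity)]
  linarith

theorem norm_saturableF_le (z : ℂ) : ‖saturableF z‖ ≤ ‖z‖ := by
  rw [saturableF, norm_mul, Complex.norm_real, Real.norm_of_nonneg (by positivity)]
  exact mul_le_of_le_one_left (norm_nonneg _) (saturable_ratio_le_one _)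

theorem norm_saturableF_sub_le (z w : ℂ) :
    ‖saturableF z - saturableF w‖ ≤ 9 / 8 * ‖z - w‖ :=
  norm_radial_sub_le (φ := fun r => r ^ 2 / (1 + r ^ 2)) z w (by norm_num) (by positivity)
    (by positivity) ((saturable_ratio_le_one _).trans (by norm_num))
    ((saturable_ratio_le_one _).trans (by norm_num)) (abs_saturable_profile_sub_le _ _)

theorem admissible_saturableF {V χ R : ℝ} (hV : V ≠ 0) (hχ : |χ| < chiSaturable V) (hR : 9 ≤ R) :
    Admissible V χ saturableF R (9 / 8) R := by
  have hN := normA_pos hV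
  have hcrit : |χ| * (9 * normA V) < 8 := by
    rwa [chiSaturable, lt_div_iff₀ (by positivity)] at hχ
  refine ⟨hV, continuous_saturableF, by simp [saturableF], by norm_num,
    fun z w _ _ => norm_saturableF_sub_le z w, by linarith,
    fun z hz => (norm_saturableF_le z).trans hz, by linarith, ?_⟩
  have h1 : |χ| * normA V < 8 / 9 := by linarith
  have := mul_lt_mul_of_pos_right h1 (show 0 < R by linarith)
  linarith

/-! ### Comparison of the critical values -/

/-- The function `(1 + 2σ) (1 + 1/(2σ))^{2σ}`, the Lipschitz constant of the power nonlinearity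
on the invariant ball. -/
def powerConst (σ : ℝ) : ℝ := (1 + 2 * σ) * (1 + 1 / (2 * σ)) ^ (2 * σ)

theorem powerConst_pos {σ : ℝ} (hσ : 0 < σ) : 0 < powerConst σ := by
  unfold powerConst; positivity

theorem log_powerConst {σ : ℝ} (hσ : 0 < σ) :
    Real.log (powerConst σ) =
      (1 + 2 * σ) * Real.log (1 + 2 * σ) - 2 * σ * Real.log (2 * σ) := by
  rw [powerConst, Real.log_mul (by positivity) (by positivity), Real.log_rpow (by positivity),
    show 1 + 1 / (2 * σ) = (1 + 2 * σ) / (2 * σ) by field_simp; ring,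
    Real.log_div (by positivity) (by positivity)]
  ring

/-- With `x = 2σ`, the logarithm `(1 + x) log (1 + x) - x log x` has derivative
`log (1 + x) - log x > 0`. -/
theorem strictMonoOn_powerConst : StrictMonoOn powerConst (Ioi 0) := by
  have hmono : StrictMonoOn
      (fun x : ℝ => (1 + x) * Real.log (1 + x) - x * Real.log x) (Ioi 0) := by
    have hder : ∀ x ∈ Ioi (0 : ℝ), HasDerivAt
        (fun x : ℝ => (1 + x) * Real.log (1 + x) - x * Real.log x)
        (Real.log (1 + x) - Real.log x) x := by
      intro x hx
      have hx : 0 < x := hx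
      have h1 : HasDerivAt (fun x : ℝ => (1 + x) * Real.log (1 + x)) (Real.log (1 + x) + 1) x := by
        simpa using (Real.hasDerivAt_mul_log (x := 1 + x) (by positivity)).comp_const_add 1 x
      convert! h1.sub (Real.hasDerivAt_mul_log hx.ne') using 1
      ring
    refine strictMonoOn_of_deriv_pos (convex_Ioi 0)
      (fun x hx => (hder x hx).continuousAt.continuousWithinAt) fun x hx => ?_
    rw [interior_Ioi] at hx
    rw [(hder x hx).deriv, sub_pos]
    exact Real.log_lt_log hx (by linarith)
  intro s hs t ht hst
  have hs : 0 < s := hs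
  have ht : 0 < t := ht
  rw [← Real.log_lt_log_iff (powerConst_pos hs) (powerConst_pos ht), log_powerConst hs,
    log_powerConst ht]
  exact hmono (show 2 * s ∈ Ioi (0 : ℝ) from mem_Ioi.2 (by linarith))
    (show 2 * t ∈ Ioi (0 : ℝ) from mem_Ioi.2 (by linarith)) (by linarith)

theorem continuousOn_powerConst : ContinuousOn powerConst (Ioi 0) := by
  intro σ hσ
  have hσ : 0 < σ := hσ
  have h2 : (2 * σ) ≠ 0 := by positivity
  have h1 : ContinuousAt (fun σ : ℝ => 1 + 1 / (2 * σ)) σ :=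
    continuousAt_const.add (continuousAt_const.div (by fun_prop) h2)
  exact ((by fun_prop : ContinuousAt (fun σ : ℝ => 1 + 2 * σ) σ).mul
    (h1.rpow (by fun_prop) (Or.inl (by positivity)))).continuousWithinAt

theorem powerConst_one_div_hundred : powerConst (1 / 100) < 9 / 8 := by
  have h : (51 : ℝ) ^ (1 / 50 : ℝ) < 225 / 204 := by
    rw [one_div, Real.rpow_inv_lt_iff_of_pos (by norm_num) (by norm_num) (by norm_num)]
    norm_num
  have e : powerConst (1 / 100) = 51 / 50 * (51 : ℝ) ^ (1 / 50 : ℝ) := by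
    unfold powerConst; norm_num
  rw [e]; linarith

theorem lt_powerConst_one_div_fifty : 9 / 8 < powerConst (1 / 50) := by
  have h : 225 / 208 < (26 : ℝ) ^ (1 / 25 : ℝ) := by
    rw [one_div, Real.lt_rpow_inv_iff_of_pos (by norm_num) (by norm_num) (by norm_num)]
    norm_num
  have e : powerConst (1 / 50) = 26 / 25 * (26 : ℝ) ^ (1 / 25 : ℝ) := by
    unfold powerConst; norm_num
  rw [e]; linarith

theorem exists_threshold : ∃ σ₀ : ℝ, 1 / 100 < σ₀ ∧ σ₀ < 1 / 50 ∧ powerConst σ₀ = 9 / 8 := by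
  have hsub : Icc (1 / 100 : ℝ) (1 / 50) ⊆ Ioi 0 := fun x hx =>
    mem_Ioi.2 (lt_of_lt_of_le (by norm_num) hx.1)
  obtain ⟨σ₀, h, h'⟩ := intermediate_value_Ioo (by norm_num)
    (continuousOn_powerConst.mono hsub) ⟨powerConst_one_div_hundred, lt_powerConst_one_div_fifty⟩
  exact ⟨σ₀, h.1, h.2, h'⟩

theorem chiPower_lt_chiSaturable_iff {V σ : ℝ} (hV : V ≠ 0) (hσ : 0 < σ) :
    chiPower V σ < chiSaturable V ↔ 9 / 8 < powerConst σ := by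
  have hN := normA_pos hV
  have hp := powerConst_pos hσ
  have e1 : chiPower V σ = 1 / (powerConst σ * normA V) := rfl
  have e2 : chiSaturable V = 1 / (9 / 8 * normA V) := by
    rw [chiSaturable]; field_simp
  rw [e1, e2, one_div_lt_one_div (by positivity) (by positivity), mul_lt_mul_iff_left₀ hN]

end

end DNLS

theorem theorem3p1 :
    (∀ V : ℝ, V ≠ 0 → MemLp (DNLS.A V) ⊤ DNLS.halfLine ∧ 0 < DNLS.normA V) ∧
    -- (a) power nonlinearity, on the ball of radius `1 + 1/(2σ)`
    (∀ V σ χ : ℝ, V ≠ 0 → 0 < σ → |χ| < DNLS.chiPower V σ →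
      (∃ Φ : DNLS.Ball (1 + 1 / (2 * σ)) → DNLS.Ball (1 + 1 / (2 * σ)),
        (∀ u, ((Φ u : DNLS.LInfty) : ℝ → ℂ) =ᵐ[DNLS.halfLine]
          DNLS.volterra V χ (DNLS.powerF σ) ((u : DNLS.LInfty) : ℝ → ℂ)) ∧
        ContractingWith (Real.toNNReal (|χ| / DNLS.chiPower V σ)) Φ ∧
        ∃ u₀, Function.fixedPoints Φ = {u₀} ∧
          ∀ C, DNLS.IsSolution V χ (DNLS.powerF σ) C →
            ((u₀ : DNLS.LInfty) : ℝ → ℂ) =ᵐ[DNLS.halfLine] fun t => C t 0) ∧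
      (∃ C, DNLS.IsSolution V χ (DNLS.powerF σ) C) ∧
      (∀ C, DNLS.IsSolution V χ (DNLS.powerF σ) C →
        (∀ t : ℝ, 0 ≤ t →
          C t 0 = DNLS.volterra V χ (DNLS.powerF σ) (fun s => C s 0) t) ∧
        Tendsto (fun t => ‖C t 0‖) atTop (𝓝 0))) ∧
    -- (a) saturable nonlinearity, on every ball of radius at least `9`
    (∀ V χ : ℝ, V ≠ 0 → |χ| < DNLS.chiSaturable V →
      (∀ R : ℝ, 9 ≤ R → ∃ Φ : DNLS.Ball R → DNLS.Ball R,
        (∀ u, ((Φ u : DNLS.LInfty) : ℝ → ℂ) =ᵐ[DNLS.halfLine]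
          DNLS.volterra V χ DNLS.saturableF ((u : DNLS.LInfty) : ℝ → ℂ)) ∧
        ContractingWith (Real.toNNReal (|χ| / DNLS.chiSaturable V)) Φ ∧
        ∃ u₀, Function.fixedPoints Φ = {u₀} ∧
          ∀ C, DNLS.IsSolution V χ DNLS.saturableF C →
            ((u₀ : DNLS.LInfty) : ℝ → ℂ) =ᵐ[DNLS.halfLine] fun t => C t 0) ∧
      (∃ C, DNLS.IsSolution V χ DNLS.saturableF C) ∧
      (∀ C, DNLS.IsSolution V χ DNLS.saturableF C →
        (∀ t : ℝ, 0 ≤ t →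
          C t 0 = DNLS.volterra V χ DNLS.saturableF (fun s => C s 0) t) ∧
        Tendsto (fun t => ‖C t 0‖) atTop (𝓝 0))) ∧
    -- (b) comparison of the two critical values
    (∃ σ₀ : ℝ, 1 / 100 < σ₀ ∧ σ₀ < 1 / 50 ∧
      ∀ V σ : ℝ, V ≠ 0 → 0 < σ →
        (DNLS.chiPower V σ < DNLS.chiSaturable V ↔ σ₀ < σ)) := by
  refine ⟨fun V hV => ⟨DNLS.memLp_A hV, DNLS.normA_pos hV⟩, ?_, ?_, ?_⟩
  · intro V σ χ hV hσ hχ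
    have e : |χ| / DNLS.chiPower V σ =
        |χ| * ((1 + 2 * σ) * (1 + 1 / (2 * σ)) ^ (2 * σ) * DNLS.normA V) := by
      rw [DNLS.chiPower, div_div_eq_mul_div, div_one]
    rw [e]
    exact (DNLS.admissible_powerF hV hσ hχ).main
  · intro V χ hV hχ
    have e : |χ| / DNLS.chiSaturable V = |χ| * (9 / 8 * DNLS.normA V) := by
      rw [DNLS.chiSaturable, div_div_eq_mul_div]
      ring
    rw [e]
    exact ⟨fun R hR => (DNLS.admissible_saturableF hV hχ hR).main.1,
      (DNLS.admissible_saturableF hV hχ le_rfl).main.2⟩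
  · obtain ⟨σ₀, h1, h2, h3⟩ := DNLS.exists_threshold
    refine ⟨σ₀, h1, h2, fun V σ hV hσ => ?_⟩
    have hσ₀ : 0 < σ₀ := by linarith
    rw [DNLS.chiPower_lt_chiSaturable_iff hV hσ, ← h3]
    exact DNLS.strictMonoOn_powerConst.lt_iff_lt hσ₀ hσ
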